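/- A replication-insertion channel $\mathsf{Ch}_{(M,\mathcal R,p_{\mathsf{flip}})}$ is given by a constant $p_{\mathsf{flip}}\in[0,1/2)$ and a joint distribution of $(M,\mathcal R)$ with $M\in\{0,1,2,\dots\}$ and $\mathcal R\subseteq\{1,\dots,M\}$, such that $\Pr[M>0]>0$ and $\Pr[\mathcal R\neq\emptyset]>0$. On input $x\in\{-1,1\}^n$ it acts independently on each bit $x_i$: it samples $(m_i,\mathcal R_i)$ from the distribution of $(M,\mathcal R)$ and outputs a string $Y_{x_i}\in\{-1,1\}^{m_i}$ whose letters are independent given $(m_i,\mathcal R_i)$; for $j\in\mathcal R_i$ the $j$-th letter is $-x_i$ with probability $p_{\mathsf{flip}}$ and $x_i$ otherwise, and for $j\notin\mathcal R_i$ it is a uniformly random bit. A trace of $x$ is the concatenation $Y_x=Y_{x_1}\|\cdots\|Y_{x_n}$. Let $Y'_x$ be $Y_x$ padded with zeros on the right to an infinite sequence, and let $\mu_x=(\mathbb E[Y'_{x,1}],\mathbb E[Y'_{x,2}],\dots)$ be the mean trace. Given $t$ independent traces of $x$, padded to $T^{(1)},\dots,T^{(t)}$, mean-based reconstruction computes $\widehat\mu_i=\frac1t\sum_{j=1}^t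 T^{(j)}_i$ for $i\ge 1$ and outputs a string $\widehat x\in\{-1,1\}^n$ that minimizes $\|\mu_{\widehat x}-\widehat\mu\|_1$ (ties broken arbitrarily). Theorem. Let $\mathsf{Ch}_{(M,\mathcal R,p_{\mathsf{flip}})}$ be a replication-insertion channel such that $M$ is sub-exponential, i.e. there is a constant $\alpha>0$ with $\Pr[|M|\ge\tau]\le 2e^{-\alpha\tau}$ for all $\tau\ge 0$. Then $\exp(O(n^{1/3}))$ traces suffice for worst-case mean-based trace reconstruction with success probability at least $1-e^{-\Omega(n)}$: there are constants $C,c>0$, depending only on the channel, such that for all $n$, all $t\ge\exp(Cn^{1/3})$ and every $x\in\{-1,1\}^n$, mean-based reconstruction from $t$ independent traces of $x$ outputs $\widehat x=x$ with probability at least $1-e^{-cn}$. -/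

import Mathlib

open MeasureTheory
open scoped NNReal ENNReal

noncomputable section

namespace TraceReconstruction

/-- Strings over `{-1, 1}` (the type `ℤˣ` has exactly the elements `1` and `-1`), with the discrete
σ-algebra. -/
instance instMeasurableSpaceListUnits : MeasurableSpace (List ℤˣ) := ⊤

instance instDiscreteMeasurableSpaceListUnits : DiscreteMeasurableSpace (List ℤˣ) :=
  ⟨fun _ => trivial⟩

/-- A replication-insertion channel: a joint law of a length `M` and a set `R` of positions among
the `M` positions of the block (numbered from `0`), and a flip probability in `[0, 1/2)`. -/
structure ReplicationInsertionChannel where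
  /-- The joint law of `(M, R)`. -/
  law : PMF (Σ m : ℕ, Finset (Fin m))
  /-- The probability that a replicated bit is flipped. -/
  pflip : ℝ≥0
  pflip_lt_half : pflip < 1 / 2
  length_pos : 0 < law.toOuterMeasure {a | 0 < a.1}
  replications_nonempty : 0 < law.toOuterMeasure {a | a.2.Nonempty}

/-- The law of the concatenation of independent random strings with the given laws. -/
def concatIndep : List (PMF (List ℤˣ)) → PMF (List ℤˣ)
  | [] => PMF.pure []
  | p :: ps => p.bind fun y => (concatIndep ps).map fun z => y ++ z

/-- A real random variable `X` is sub-exponential if `P(|X| ≥ τ) ≤ 2 exp (-α τ)` for some `α > 0`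
and all `τ ≥ 0`. -/
def IsSubExponential {Ω : Type*} [MeasurableSpace Ω] (X : Ω → ℝ) (P : Measure Ω) : Prop :=
  ∃ α : ℝ, 0 < α ∧ ∀ τ : ℝ, 0 ≤ τ → P.real {ω | τ ≤ |X ω|} ≤ 2 * Real.exp (-α * τ)

namespace ReplicationInsertionChannel

variable (ch : ReplicationInsertionChannel)

/-- The law of the block length `M`. -/
def lengthLaw : PMF ℕ := ch.law.map Sigma.fst

theorem pflip_le_one : ch.pflip ≤ 1 :=
  ch.pflip_lt_half.le.trans (by norm_num)

theorem sum_noisyCopy (b : ℤˣ) :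
    ∑ u : ℤˣ, (if u = b then 1 - (ch.pflip : ℝ≥0∞) else (ch.pflip : ℝ≥0∞)) = 1 := by
  have h : (ch.pflip : ℝ≥0∞) ≤ 1 := by exact_mod_cast ch.pflip_le_one
  have hu : (Finset.univ : Finset ℤˣ) = {1, -1} := rfl
  rcases Int.units_eq_one_or b with rfl | rfl <;>
    simp [hu, h, add_tsub_cancel_of_le, tsub_add_cancel_of_le]

/-- A noisy copy of the bit `b`: it is `-b` with probability `pflip` and `b` otherwise. -/
def noisyCopy (b : ℤˣ) : PMF ℤˣ :=
  PMF.ofFintype (fun u => if u = b then 1 - (ch.pflip : ℝ≥0∞) else (ch.pflip : ℝ≥0∞))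
    (ch.sum_noisyCopy b)

/-- The law of the random string into which the channel turns the single bit `b`: given `(M, R)`,
its `M` letters are independent, noisy copies of `b` at the positions in `R` and uniformly random
bits elsewhere. -/
def symbolOutput (b : ℤˣ) : PMF (List ℤˣ) :=
  ch.law.bind fun a => concatIndep <| List.ofFn fun j : Fin a.1 =>
    (if j ∈ a.2 then ch.noisyCopy b else PMF.uniformOfFintype ℤˣ).map fun u => [u]

/-- The trace distribution on input `x`. -/
def traceLaw {n : ℕ} (x : Fin n → ℤˣ) : PMF (List ℤˣ) :=
  concatIndep <| List.ofFn fun i => ch.symbolOutput (x i)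

/-- The law of `t` independent traces of `x`. -/
def tracesMeasure {n : ℕ} (x : Fin n → ℤˣ) (t : ℕ) : Measure (Fin t → List ℤˣ) :=
  Measure.pi fun _ => (ch.traceLaw x).toMeasure

end ReplicationInsertionChannel

/-- The string `y`, padded with zeros on the right to an infinite real sequence. -/
def padded (y : List ℤˣ) (i : ℕ) : ℝ :=
  (y[i]?).elim 0 fun u => ((u : ℤ) : ℝ)

/-- The mean trace of `x`: the expectations of the coordinates of the padded trace. -/
def ReplicationInsertionChannel.meanTrace (ch : ReplicationInsertionChannel) {n : ℕ}
    (x : Fin n → ℤˣ) (i : ℕ) : ℝ :=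
  ∫ y, padded y i ∂(ch.traceLaw x).toMeasure

/-- The empirical mean of `t` traces. -/
def empiricalMean {t : ℕ} (T : Fin t → List ℤˣ) (i : ℕ) : ℝ :=
  (1 / (t : ℝ)) * ∑ j, padded (T j) i

/-- The `ℓ¹` distance of two real sequences, possibly infinite. -/
def l1Dist (a b : ℕ → ℝ) : ℝ≥0∞ := ∑' i, ENNReal.ofReal |a i - b i|

/-- A mean-based reconstruction procedure for inputs of length `n`: given an estimate `ν` of the
mean trace, it outputs a string whose mean trace is at minimal `ℓ¹` distance from `ν`
(ties are broken arbitrarily). -/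
def ReplicationInsertionChannel.IsMeanBasedDecoder (ch : ReplicationInsertionChannel) {n : ℕ}
    (dec : (ℕ → ℝ) → (Fin n → ℤˣ)) : Prop :=
  ∀ (ν : ℕ → ℝ) (y : Fin n → ℤˣ), l1Dist (ch.meanTrace (dec ν)) ν ≤ l1Dist (ch.meanTrace y) ν

theorem ReplicationInsertionChannel.exists_isMeanBasedDecoder (ch : ReplicationInsertionChannel)
    (n : ℕ) : ∃ dec : (ℕ → ℝ) → (Fin n → ℤˣ), ch.IsMeanBasedDecoder dec :=
  Classical.skolem.1 fun ν => Finite.exists_min fun y : Fin n → ℤˣ => l1Dist (ch.meanTrace y) ν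

end TraceReconstruction

end

/-! Let `g` be the probability generating function of the block length and `F` that of the expected
set of replicated positions. Uniform letters have mean zero, and the `i`-th block is shifted by the
lengths of `i` independent blocks. Hence, for `‖z‖ ≤ 1`, the power series of the mean trace at `z`
is `(1 - 2 p) F(z) ∑ x_i g(z)^i`. Coefficients are weighted by powers of norm at most `1`, so the
modulus of the difference of two such series bounds the `ℓ¹` distance of the mean traces from below.

It remains to find `z` making this difference at least `exp (-O(n^(1/3)))`. Write `∑ (x_i - x'_i)
w^i` as `2 w^k B(w)`, with coefficients of `B` in `{-1, 0, 1}` and nonzero constant term, and take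
`z = s + (1 - s) e^(iθ)` with `|θ| ≤ π / L`, on a circle tangent to the unit circle at `1`. Second
moments give `‖g(z)‖ ≥ exp (-O(θ²))` and `‖F(z)‖ ≥ κ > 0` near `1`
(`lengthGen_replicationGen_lower_bound`). For `B(g(z))`, a product over `L` rotations and the
maximum principle (`exists_arc_le_norm`) give `exp (-O(L))` at some point of the arc, provided
`B(g(s))` at the centre is bounded below. No fixed centre serves every `B`; compactness of the
coefficient space and the identity theorem give a uniform bound when `s` may depend on `B`
(`exists_lower_bound_lengthGen`). The losses are `n / L²` and `L` in the exponent, balanced at `L ≍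
n^(1/3)`.

The empirical mean must then be within half this separation of the true one. Sub-exponential lengths
make the coordinates beyond `K n` negligible by Markov's inequality, and Hoeffding's inequality
controls the others. -/

noncomputable section

namespace TraceReconstruction

/-! ### Expectations under discrete laws -/

section Expectation

variable {α β : Type*}

/-- The expectation of a nonnegative function under a discrete law. -/
def lexp (p : PMF α) (f : α → ℝ≥0∞) : ℝ≥0∞ := ∑' a, p a * f a

/-- The expectation of a complex function under a discrete law. -/
def mean (p : PMF α) (f : α → ℂ) : ℂ := ∑' a, ((p a).toReal : ℂ) * f a

theorem lexp_mono (p : PMF α) {f g : α → ℝ≥0∞} (h : ∀ a, f a ≤ g a) : lexp p f ≤ lexp p g :=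
  ENNReal.tsum_le_tsum fun a => by gcongr; exact h a

theorem lexp_const (p : PMF α) (c : ℝ≥0∞) : lexp p (fun _ => c) = c := by
  simp [lexp, ENNReal.tsum_mul_right, p.tsum_coe]

theorem lexp_const_mul (p : PMF α) (c : ℝ≥0∞) (f : α → ℝ≥0∞) :
    lexp p (fun a => c * f a) = c * lexp p f := by
  simp only [lexp, ← ENNReal.tsum_mul_left]
  exact tsum_congr fun a => by ring

theorem lexp_mul_const (p : PMF α) (c : ℝ≥0∞) (f : α → ℝ≥0∞) :
    lexp p (fun a => f a * c) = lexp p f * c := by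
  simp only [mul_comm _ c, lexp_const_mul]

theorem lexp_add (p : PMF α) (f g : α → ℝ≥0∞) :
    lexp p (fun a => f a + g a) = lexp p f + lexp p g := by
  simp only [lexp, mul_add, ENNReal.tsum_add]

theorem lexp_pure (a : α) (f : α → ℝ≥0∞) : lexp (PMF.pure a) f = f a := by
  classical
  rw [lexp, tsum_eq_single a (by intro b hb; simp [hb])]
  simp

theorem lexp_bind (p : PMF α) (q : α → PMF β) (f : β → ℝ≥0∞) :
    lexp (p.bind q) f = lexp p fun a => lexp (q a) f := by
  simp only [lexp, PMF.bind_apply, ← ENNReal.tsum_mul_right, ← ENNReal.tsum_mul_left]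
  rw [ENNReal.tsum_comm]
  simp only [mul_assoc]

theorem lexp_map (p : PMF α) (g : α → β) (f : β → ℝ≥0∞) :
    lexp (p.map g) f = lexp p fun a => f (g a) := by
  simp only [PMF.map, lexp_bind, Function.comp, lexp_pure]

theorem enorm_toReal_mul (p : PMF α) (f : α → ℂ) (a : α) :
    ‖((p a).toReal : ℂ) * f a‖ₑ = p a * ‖f a‖ₑ := by
  rw [enorm_mul]
  congr 1
  rw [← ofReal_norm, Complex.norm_real, Real.norm_of_nonneg ENNReal.toReal_nonneg,
    ENNReal.ofReal_toReal (p.apply_ne_top a)]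

theorem summable_mean {p : PMF α} {f : α → ℂ} (h : lexp p (fun a => ‖f a‖ₑ) ≠ ⊤) :
    Summable fun a => ((p a).toReal : ℂ) * f a := by
  refine Summable.of_norm (tsum_enorm_ne_top_iff_summable_norm.1 ?_)
  simpa only [enorm_toReal_mul, lexp] using h

theorem enorm_mean_le (p : PMF α) (f : α → ℂ) : ‖mean p f‖ₑ ≤ lexp p fun a => ‖f a‖ₑ := by
  refine (enorm_tsum_le_tsum_enorm).trans (le_of_eq ?_)
  simp only [enorm_toReal_mul, lexp]

theorem mean_pure (a : α) (f : α → ℂ) : mean (PMF.pure a) f = f a := by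
  classical
  rw [mean, tsum_eq_single a (by intro b hb; simp [hb])]
  simp

theorem mean_const (p : PMF α) (c : ℂ) : mean p (fun _ => c) = c := by
  rw [mean, tsum_mul_right, ← Complex.ofReal_tsum, ← ENNReal.tsum_toReal_eq p.apply_ne_top,
    p.tsum_coe]
  simp

theorem mean_const_mul (p : PMF α) (c : ℂ) (f : α → ℂ) :
    mean p (fun a => c * f a) = c * mean p f := by
  simp only [mean, ← tsum_mul_left]
  exact tsum_congr fun a => by ring

theorem mean_mul_const (p : PMF α) (c : ℂ) (f : α → ℂ) :
    mean p (fun a => f a * c) = mean p f * c := by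
  simp only [mul_comm _ c, mean_const_mul]

theorem mean_add {p : PMF α} {f g : α → ℂ} (hf : lexp p (fun a => ‖f a‖ₑ) ≠ ⊤)
    (hg : lexp p (fun a => ‖g a‖ₑ) ≠ ⊤) :
    mean p (fun a => f a + g a) = mean p f + mean p g := by
  simp only [mean, mul_add]
  exact (summable_mean hf).tsum_add (summable_mean hg)

theorem mean_sub {p : PMF α} {f g : α → ℂ} (hf : lexp p (fun a => ‖f a‖ₑ) ≠ ⊤)
    (hg : lexp p (fun a => ‖g a‖ₑ) ≠ ⊤) :
    mean p (fun a => f a - g a) = mean p f - mean p g := by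
  simp only [mean, mul_sub]
  exact (summable_mean hf).tsum_sub (summable_mean hg)

/-- Fubini for series. Finiteness of the `lexp` of the norm is what makes the double series
summable; without it `tsum` could take its default value `0`. -/
theorem mean_bind {p : PMF α} {q : α → PMF β} {f : β → ℂ}
    (h : lexp (p.bind q) (fun b => ‖f b‖ₑ) ≠ ⊤) :
    mean (p.bind q) f = mean p fun a => mean (q a) f := by
  have hs : Summable (Function.uncurry fun (a : α) (b : β) =>
      ((p a).toReal : ℂ) * (((q a b).toReal : ℂ) * f b)) := by
    refine Summable.of_norm (tsum_enorm_ne_top_iff_summable_norm.1 ?_)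
    rw [ENNReal.tsum_prod']
    rw [lexp_bind] at h
    convert h using 1
    refine tsum_congr fun a => ?_
    simp only [lexp, ← ENNReal.tsum_mul_left]
    refine tsum_congr fun b => ?_
    rw [← enorm_toReal_mul (q a) f b, ← enorm_toReal_mul p (fun _ => _) a]
    rfl
  have hswap := hs.tsum_comm
  simp only [mean, ← tsum_mul_left]
  rw [← hswap]
  refine tsum_congr fun b => ?_
  rw [PMF.bind_apply, ENNReal.tsum_toReal_eq
    (fun a => ENNReal.mul_ne_top (p.apply_ne_top a) ((q a).apply_ne_top b)), Complex.ofReal_tsum,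
    ← tsum_mul_right]
  refine tsum_congr fun a => ?_
  rw [ENNReal.toReal_mul, Complex.ofReal_mul, mul_assoc]

theorem mean_map {p : PMF α} {g : α → β} {f : β → ℂ} (h : lexp p (fun a => ‖f (g a)‖ₑ) ≠ ⊤) :
    mean (p.map g) f = mean p fun a => f (g a) := by
  rw [PMF.map, mean_bind (by rwa [← PMF.map, lexp_map])]
  simp only [Function.comp, mean_pure]

theorem lexp_enorm_ne_top_of_bounded (p : PMF α) {f : α → ℂ} {C : ℝ≥0} (h : ∀ a, ‖f a‖ ≤ C) :
    lexp p (fun a => ‖f a‖ₑ) ≠ ⊤ := by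
  refine ne_top_of_le_ne_top (ENNReal.coe_ne_top (r := C)) ?_
  refine (lexp_mono p fun a => ?_).trans_eq (lexp_const p (C : ℝ≥0∞))
  rw [enorm_eq_nnnorm]
  exact_mod_cast h a

end Expectation

/-! ### Strings as polynomials and as padded sequences -/

section Strings

/-- The polynomial whose coefficients are the letters of a string. -/
def letterPoly (z : ℂ) : List ℤˣ → ℂ
  | [] => 0
  | u :: y => ((u : ℤ) : ℂ) + z * letterPoly z y

theorem norm_units_complex (u : ℤˣ) : ‖((u : ℤ) : ℂ)‖ = 1 := by
  rcases Int.units_eq_one_or u with rfl | rfl <;> simp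

theorem letterPoly_append (z : ℂ) (a b : List ℤˣ) :
    letterPoly z (a ++ b) = letterPoly z a + z ^ a.length * letterPoly z b := by
  induction a with
  | nil => simp [letterPoly]
  | cons u a ih => simp only [List.cons_append, letterPoly, ih, List.length_cons]; ring

theorem norm_letterPoly_le {z : ℂ} (hz : ‖z‖ ≤ 1) (y : List ℤˣ) :
    ‖letterPoly z y‖ ≤ y.length := by
  induction y with
  | nil => simp [letterPoly]
  | cons u y ih =>
    simp only [letterPoly, List.length_cons, Nat.cast_add, Nat.cast_one]
    calc _ ≤ ‖((u : ℤ) : ℂ)‖ + ‖z‖ * ‖letterPoly z y‖ := (norm_add_le _ _).trans (by rw [norm_mul])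
      _ ≤ 1 + 1 * y.length := by
        rw [norm_units_complex]
        gcongr
      _ = _ := by ring

theorem enorm_letterPoly_le {z : ℂ} (hz : ‖z‖ ≤ 1) (y : List ℤˣ) :
    ‖letterPoly z y‖ₑ ≤ y.length := by
  rw [← ofReal_norm, ← ENNReal.ofReal_natCast]
  exact ENNReal.ofReal_le_ofReal (norm_letterPoly_le hz y)

theorem padded_cons_zero (u : ℤˣ) (y : List ℤˣ) : padded (u :: y) 0 = ((u : ℤ) : ℝ) := by
  simp [padded]

theorem padded_cons_succ (u : ℤˣ) (y : List ℤˣ) (i : ℕ) : padded (u :: y) (i + 1) = padded y i := by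
  simp [padded]

theorem padded_of_length_le {y : List ℤˣ} {i : ℕ} (h : y.length ≤ i) : padded y i = 0 := by
  simp [padded, h]

theorem abs_padded_le (y : List ℤˣ) (i : ℕ) : |padded y i| ≤ 1 := by
  unfold padded
  rcases h : y[i]? with _ | u
  · simp
  · rcases Int.units_eq_one_or u with rfl | rfl <;> simp

theorem letterPoly_eq_sum (z : ℂ) (y : List ℤˣ) {N : ℕ} (hN : y.length ≤ N) :
    letterPoly z y = ∑ i ∈ Finset.range N, (padded y i : ℂ) * z ^ i := by
  induction y generalizing N with
  | nil => simp [letterPoly, padded]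
  | cons u y ih =>
    obtain ⟨N, rfl⟩ : ∃ M, N = M + 1 := ⟨N - 1, by simp at hN; omega⟩
    rw [Finset.sum_range_succ', letterPoly, ih (N := N) (by simpa using hN), Finset.mul_sum,
      padded_cons_zero, add_comm]
    simp only [padded_cons_succ, pow_succ]
    congr 1
    · exact Finset.sum_congr rfl fun i _ => by ring
    · simp

end Strings

/-! ### Concatenation of independent blocks -/

section Concatenation

theorem lexp_concatIndep_cons (p : PMF (List ℤˣ)) (ps : List (PMF (List ℤˣ)))
    (f : List ℤˣ → ℝ≥0∞) :
    lexp (concatIndep (p :: ps)) f = lexp p fun y => lexp (concatIndep ps) fun z => f (y ++ z) := by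
  simp only [concatIndep, lexp_bind, lexp_map]

theorem mean_concatIndep_cons {p : PMF (List ℤˣ)} {ps : List (PMF (List ℤˣ))} {f : List ℤˣ → ℂ}
    (h : lexp (concatIndep (p :: ps)) (fun y => ‖f y‖ₑ) ≠ ⊤) :
    mean (concatIndep (p :: ps)) f = mean p fun y => mean (concatIndep ps) fun z => f (y ++ z) := by
  have h' := h
  rw [lexp_concatIndep_cons] at h'
  rw [concatIndep, mean_bind (by rwa [concatIndep] at h)]
  refine tsum_congr fun y => ?_
  -- Integrability of the inner function is only known for `y` of positive mass; elsewhere the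
  -- weight kills whatever value `mean` takes.
  by_cases hy : p y = 0
  · simp [hy]
  congr 1
  refine mean_map fun ht => h' ?_
  refine ENNReal.tsum_eq_top_of_eq_top ⟨y, ?_⟩
  simp only [ht, ENNReal.mul_top hy]

theorem lexp_pow_length_concatIndep (v : ℝ≥0∞) (ps : List (PMF (List ℤˣ))) :
    lexp (concatIndep ps) (fun y => v ^ y.length) =
      (ps.map fun p => lexp p fun y => v ^ y.length).prod := by
  induction ps with
  | nil => simp [concatIndep, lexp_pure]
  | cons p ps ih =>
    simp only [lexp_concatIndep_cons, List.length_append, pow_add, lexp_const_mul, lexp_mul_const,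
      ih, List.map_cons, List.prod_cons]

theorem lexp_length_concatIndep (ps : List (PMF (List ℤˣ))) :
    lexp (concatIndep ps) (fun y => (y.length : ℝ≥0∞)) =
      (ps.map fun p => lexp p fun y => (y.length : ℝ≥0∞)).sum := by
  induction ps with
  | nil => simp [concatIndep, lexp_pure]
  | cons p ps ih =>
    simp only [lexp_concatIndep_cons, List.length_append, Nat.cast_add, lexp_add, lexp_const,
      ih, List.map_cons, List.sum_cons]

theorem lexp_enorm_pow_length_ne_top (p : PMF (List ℤˣ)) {z : ℂ} (hz : ‖z‖ ≤ 1) :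
    lexp p (fun y => ‖z ^ y.length‖ₑ) ≠ ⊤ :=
  lexp_enorm_ne_top_of_bounded p (C := 1) fun y => by
    simpa using pow_le_one₀ (norm_nonneg z) hz

theorem mean_pow_length_concatIndep {z : ℂ} (hz : ‖z‖ ≤ 1) (ps : List (PMF (List ℤˣ))) :
    mean (concatIndep ps) (fun y => z ^ y.length) =
      (ps.map fun p => mean p fun y => z ^ y.length).prod := by
  induction ps with
  | nil => simp [concatIndep, mean_pure]
  | cons p ps ih =>
    rw [mean_concatIndep_cons (lexp_enorm_pow_length_ne_top _ hz)]
    simp only [List.length_append, pow_add, mean_const_mul, mean_mul_const,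
      ih, List.map_cons, List.prod_cons]

theorem lexp_enorm_letterPoly_ne_top {p : PMF (List ℤˣ)} {z : ℂ} (hz : ‖z‖ ≤ 1)
    (h : lexp p (fun y => (y.length : ℝ≥0∞)) ≠ ⊤) : lexp p (fun y => ‖letterPoly z y‖ₑ) ≠ ⊤ :=
  ne_top_of_le_ne_top h (lexp_mono _ fun y => enorm_letterPoly_le hz y)

theorem mean_letterPoly_concatIndep_cons {z : ℂ} (hz : ‖z‖ ≤ 1) {p : PMF (List ℤˣ)}
    {ps : List (PMF (List ℤˣ))} (hp : lexp p (fun y => (y.length : ℝ≥0∞)) ≠ ⊤)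
    (hps : lexp (concatIndep ps) (fun y => (y.length : ℝ≥0∞)) ≠ ⊤) :
    mean (concatIndep (p :: ps)) (letterPoly z) =
      mean p (letterPoly z) +
        mean p (fun y => z ^ y.length) * mean (concatIndep ps) (letterPoly z) := by
  have h1 : ∀ y : List ℤˣ, mean (concatIndep ps) (fun w => letterPoly z (y ++ w)) =
      letterPoly z y + z ^ y.length * mean (concatIndep ps) (letterPoly z) := by
    intro y
    simp only [letterPoly_append]
    rw [mean_add, mean_const, mean_const_mul]
    · exact lexp_enorm_ne_top_of_bounded _ (C := ‖letterPoly z y‖₊) fun _ => le_rfl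
    · simp only [enorm_mul, lexp_const_mul]
      exact ENNReal.mul_ne_top enorm_ne_top (lexp_enorm_letterPoly_ne_top hz hps)
  rw [mean_concatIndep_cons]
  · simp only [h1]
    rw [mean_add (lexp_enorm_letterPoly_ne_top hz hp), mean_mul_const]
    simp only [enorm_mul, lexp_mul_const]
    exact ENNReal.mul_ne_top (lexp_enorm_pow_length_ne_top _ hz) enorm_ne_top
  · refine lexp_enorm_letterPoly_ne_top hz ?_
    rw [lexp_length_concatIndep] at hps ⊢
    simpa using ⟨hp, hps⟩

/-- The letters of block `i` are shifted by the total length of the preceding blocks, which is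
independent of that block and contributes the factor `g ^ i`. -/
theorem mean_letterPoly_concatIndep_ofFn {z g : ℂ} (hz : ‖z‖ ≤ 1) {n : ℕ}
    (f : Fin n → PMF (List ℤˣ)) (hf : ∀ i, lexp (f i) (fun y => (y.length : ℝ≥0∞)) ≠ ⊤)
    (hg : ∀ i, mean (f i) (fun y => z ^ y.length) = g) :
    mean (concatIndep (List.ofFn f)) (letterPoly z) =
      ∑ i : Fin n, g ^ (i : ℕ) * mean (f i) (letterPoly z) := by
  induction n with
  | zero => simp [concatIndep, mean_pure, letterPoly]
  | succ n ih =>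
    rw [List.ofFn_succ, mean_letterPoly_concatIndep_cons hz (hf 0), Fin.sum_univ_succ, hg 0,
      ih _ (fun i => hf _) (fun i => hg _), Finset.mul_sum]
    · simp [pow_succ', mul_assoc]
    · rw [lexp_length_concatIndep]
      simp [List.sum_ofFn, List.map_ofFn, hf]

end Concatenation

theorem sum_units {M : Type*} [AddCommMonoid M] (f : ℤˣ → M) : ∑ u : ℤˣ, f u = f 1 + f (-1) := by
  have hu : (Finset.univ : Finset ℤˣ) = {1, -1} := rfl
  simp [hu]

theorem mean_uniform_units : mean (PMF.uniformOfFintype ℤˣ) (fun u => ((u : ℤ) : ℂ)) = 0 := by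
  rw [mean, tsum_fintype, sum_units]
  simp

section Letters

variable {m : ℕ} (r : Fin m → PMF ℤˣ)

theorem lexp_pow_length_letters (v : ℝ≥0∞) :
    lexp (concatIndep (List.ofFn fun j => (r j).map fun u => [u])) (fun y => v ^ y.length) =
      v ^ m := by
  rw [lexp_pow_length_concatIndep]
  simp [List.map_ofFn, lexp_map, lexp_const, Function.comp_def]

theorem lexp_length_letters :
    lexp (concatIndep (List.ofFn fun j => (r j).map fun u => [u]))
      (fun y => (y.length : ℝ≥0∞)) = m := by
  rw [lexp_length_concatIndep]
  simp [List.map_ofFn, lexp_map, lexp_const, Function.comp_def]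

theorem mean_pow_length_letter (p : PMF ℤˣ) (z : ℂ) :
    mean (p.map fun u => [u]) (fun y => z ^ y.length) = z := by
  rw [mean_map]
  · simp [mean_const]
  · simp [lexp_const]

theorem mean_pow_length_letters {z : ℂ} (hz : ‖z‖ ≤ 1) :
    mean (concatIndep (List.ofFn fun j => (r j).map fun u => [u])) (fun y => z ^ y.length) =
      z ^ m := by
  rw [mean_pow_length_concatIndep hz]
  simp [List.map_ofFn, mean_pow_length_letter, Function.comp_def]

theorem mean_letterPoly_letters {z : ℂ} (hz : ‖z‖ ≤ 1) :
    mean (concatIndep (List.ofFn fun j => (r j).map fun u => [u])) (letterPoly z) =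
      ∑ j : Fin m, z ^ (j : ℕ) * mean (r j) (fun u => ((u : ℤ) : ℂ)) := by
  rw [mean_letterPoly_concatIndep_ofFn (g := z) hz]
  · refine Finset.sum_congr rfl fun j _ => ?_
    rw [mean_map]
    · simp [letterPoly]
    · refine lexp_enorm_ne_top_of_bounded _ (C := 1) fun u => ?_
      simpa [letterPoly] using (norm_units_complex u).le
  · simp [lexp_map, lexp_const]
  · exact fun j => mean_pow_length_letter _ _

end Letters

/-- Expectation and power series may be exchanged because each string contributes at most its length
in absolute value. -/
theorem hasSum_mean_padded {p : PMF (List ℤˣ)} (hp : lexp p (fun y => (y.length : ℝ≥0∞)) ≠ ⊤)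
    {z : ℂ} (hz : ‖z‖ ≤ 1) :
    HasSum (fun i => mean p (fun y => (padded y i : ℂ)) * z ^ i) (mean p (letterPoly z)) := by
  have hy : ∀ y : List ℤˣ, letterPoly z y = ∑' i, (padded y i : ℂ) * z ^ i := fun y => by
    rw [letterPoly_eq_sum z y le_rfl, tsum_eq_sum]
    intro i hi
    rw [padded_of_length_le (by simpa using hi)]
    simp
  have hs : Summable (Function.uncurry fun (y : List ℤˣ) (i : ℕ) =>
      ((p y).toReal : ℂ) * ((padded y i : ℂ) * z ^ i)) := by
    refine Summable.of_norm (tsum_enorm_ne_top_iff_summable_norm.1 ?_)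
    rw [ENNReal.tsum_prod']
    refine ne_top_of_le_ne_top hp (ENNReal.tsum_le_tsum fun y => ?_)
    simp only [Function.uncurry]
    have h0 : ∀ i, ‖((p y).toReal : ℂ) * ((padded y i : ℂ) * z ^ i)‖ₑ =
        p y * ‖(padded y i : ℂ) * z ^ i‖ₑ :=
      fun i => enorm_toReal_mul p (fun y => (padded y i : ℂ) * z ^ i) y
    simp only [h0, ENNReal.tsum_mul_left]
    gcongr
    rw [tsum_eq_sum (s := Finset.range y.length)]
    · calc _ ≤ ∑ i ∈ Finset.range y.length, (1 : ℝ≥0∞) := by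
            refine Finset.sum_le_sum fun i _ => ?_
            rw [← ofReal_norm, ← ENNReal.ofReal_one]
            refine ENNReal.ofReal_le_ofReal ?_
            rw [norm_mul, Complex.norm_real, norm_pow]
            exact mul_le_one₀ (abs_padded_le y i) (by positivity) (pow_le_one₀ (norm_nonneg _) hz)
        _ = _ := by simp
    · intro i hi
      rw [padded_of_length_le (by simpa using hi)]
      simp
  have h2 := (hs.prod_symm).prod
  simp only [mean, hy, ← tsum_mul_left, ← tsum_mul_right]
  rw [← hs.tsum_comm]
  simpa only [Prod.swap, Function.uncurry, mul_assoc] using h2.hasSum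

/-! ### The generating function of the mean trace -/

namespace ReplicationInsertionChannel

variable (ch : ReplicationInsertionChannel)

/-- The probability generating function of the block length. -/
def lengthGen (z : ℂ) : ℂ := mean ch.law fun a => z ^ a.1

/-- The generating function of the expected set of replicated positions. -/
def replicationGen (z : ℂ) : ℂ := mean ch.law fun a => ∑ j ∈ a.2, z ^ (j : ℕ)

theorem mean_noisyCopy (b : ℤˣ) :
    mean (ch.noisyCopy b) (fun u => ((u : ℤ) : ℂ)) = (1 - 2 * ch.pflip) * ((b : ℤ) : ℂ) := by
  have h : (ch.pflip : ℝ≥0∞) ≤ 1 := by exact_mod_cast ch.pflip_le_one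
  rw [mean, tsum_fintype, sum_units]
  rcases Int.units_eq_one_or b with rfl | rfl <;>
    simp [noisyCopy, PMF.ofFintype_apply, ENNReal.toReal_sub_of_le h] <;> ring

theorem lexp_pow_length_symbolOutput (v : ℝ≥0∞) (b : ℤˣ) :
    lexp (ch.symbolOutput b) (fun y => v ^ y.length) = lexp ch.law fun a => v ^ a.1 := by
  simp only [symbolOutput, lexp_bind, lexp_pow_length_letters]

theorem lexp_length_symbolOutput (b : ℤˣ) :
    lexp (ch.symbolOutput b) (fun y => (y.length : ℝ≥0∞)) =
      lexp ch.law fun a => (a.1 : ℝ≥0∞) := by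
  simp only [symbolOutput, lexp_bind, lexp_length_letters]

theorem mean_pow_length_symbolOutput {z : ℂ} (hz : ‖z‖ ≤ 1) (b : ℤˣ) :
    mean (ch.symbolOutput b) (fun y => z ^ y.length) = ch.lengthGen z := by
  rw [symbolOutput, mean_bind (lexp_enorm_pow_length_ne_top _ hz)]
  simp only [mean_pow_length_letters _ hz, lengthGen]

theorem mean_letterPoly_symbolOutput (hM : lexp ch.law (fun a => (a.1 : ℝ≥0∞)) ≠ ⊤)
    {z : ℂ} (hz : ‖z‖ ≤ 1) (b : ℤˣ) :
    mean (ch.symbolOutput b) (letterPoly z) =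
      (1 - 2 * ch.pflip) * ((b : ℤ) : ℂ) * ch.replicationGen z := by
  rw [symbolOutput, mean_bind, replicationGen, ← mean_const_mul]
  · refine tsum_congr fun a => ?_
    congr 1
    simp only [mean_letterPoly_letters _ hz]
    -- Inserted letters are uniform and have mean zero, so only the replicated positions survive.
    rw [← Finset.sum_subset (Finset.subset_univ a.2), Finset.mul_sum]
    · refine Finset.sum_congr rfl fun j hj => ?_
      rw [if_pos hj, mean_noisyCopy, mul_comm]
    · intro j _ hj
      rw [if_neg hj, mean_uniform_units, mul_zero]
  · refine lexp_enorm_letterPoly_ne_top hz ?_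
    have := ch.lexp_length_symbolOutput b
    rw [symbolOutput] at this
    rwa [this]

variable {n : ℕ} (x : Fin n → ℤˣ)

theorem lexp_pow_length_traceLaw (v : ℝ≥0∞) :
    lexp (ch.traceLaw x) (fun y => v ^ y.length) = (lexp ch.law fun a => v ^ a.1) ^ n := by
  rw [traceLaw, lexp_pow_length_concatIndep]
  simp [List.map_ofFn, lexp_pow_length_symbolOutput, Function.comp_def]

theorem lexp_length_traceLaw :
    lexp (ch.traceLaw x) (fun y => (y.length : ℝ≥0∞)) =
      n * lexp ch.law fun a => (a.1 : ℝ≥0∞) := by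
  rw [traceLaw, lexp_length_concatIndep]
  simp [List.map_ofFn, lexp_length_symbolOutput, Function.comp_def]

theorem lexp_length_traceLaw_ne_top (hM : lexp ch.law (fun a => (a.1 : ℝ≥0∞)) ≠ ⊤) :
    lexp (ch.traceLaw x) (fun y => (y.length : ℝ≥0∞)) ≠ ⊤ := by
  rw [lexp_length_traceLaw]
  exact ENNReal.mul_ne_top (ENNReal.natCast_ne_top n) hM

theorem mean_letterPoly_traceLaw (hM : lexp ch.law (fun a => (a.1 : ℝ≥0∞)) ≠ ⊤)
    {z : ℂ} (hz : ‖z‖ ≤ 1) :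
    mean (ch.traceLaw x) (letterPoly z) =
      (1 - 2 * ch.pflip) * ch.replicationGen z *
        ∑ i : Fin n, ((x i : ℤ) : ℂ) * ch.lengthGen z ^ (i : ℕ) := by
  rw [traceLaw, mean_letterPoly_concatIndep_ofFn (g := ch.lengthGen z) hz, Finset.mul_sum]
  · refine Finset.sum_congr rfl fun i _ => ?_
    rw [ch.mean_letterPoly_symbolOutput hM hz]
    ring
  · exact fun i => by rwa [lexp_length_symbolOutput]
  · exact fun i => ch.mean_pow_length_symbolOutput hz _

theorem integrable_padded (p : PMF (List ℤˣ)) (i : ℕ) :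
    Integrable (fun y => padded y i) p.toMeasure :=
  Integrable.of_bound (measurable_of_countable _).aestronglyMeasurable 1
    (Filter.Eventually.of_forall fun y => abs_padded_le y i)

theorem coe_meanTrace (i : ℕ) :
    (ch.meanTrace x i : ℂ) = mean (ch.traceLaw x) fun y => (padded y i : ℂ) := by
  rw [meanTrace, PMF.integral_eq_tsum _ _ (integrable_padded _ i), mean, Complex.ofReal_tsum]
  simp

/-- Since `‖z ^ i‖ ≤ 1`, a power series at `z` is bounded by the `ℓ¹` norm of its coefficients. This
turns separation of mean traces into a lower bound at a single point `z`. -/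
theorem enorm_le_l1Dist_meanTrace (hM : lexp ch.law (fun a => (a.1 : ℝ≥0∞)) ≠ ⊤)
    {z : ℂ} (hz : ‖z‖ ≤ 1) (x' : Fin n → ℤˣ) :
    ‖(1 - 2 * ch.pflip) * ch.replicationGen z *
      ∑ i : Fin n, (((x i : ℤ) : ℂ) - ((x' i : ℤ) : ℂ)) * ch.lengthGen z ^ (i : ℕ)‖ₑ ≤
      l1Dist (ch.meanTrace x) (ch.meanTrace x') := by
  have h := (hasSum_mean_padded (ch.lexp_length_traceLaw_ne_top x hM) hz).sub
    (hasSum_mean_padded (ch.lexp_length_traceLaw_ne_top x' hM) hz)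
  simp only [mean_letterPoly_traceLaw _ _ hM hz, ← mul_sub, ← Finset.sum_sub_distrib,
    ← sub_mul, ← coe_meanTrace] at h
  rw [← h.tsum_eq]
  refine enorm_tsum_le_tsum_enorm.trans (ENNReal.tsum_le_tsum fun i => ?_)
  rw [← ofReal_norm, norm_mul, norm_pow, ← Complex.ofReal_sub, Complex.norm_real]
  exact ENNReal.ofReal_le_ofReal (mul_le_of_le_one_right (abs_nonneg _)
    (pow_le_one₀ (norm_nonneg _) hz))

end ReplicationInsertionChannel

/-! ### A maximum principle on short arcs -/

section ArcBound

/-- The `L` rotates of an arc of length `2π / L` cover the circle; the root is found by rounding the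
argument. -/
theorem exists_root_of_unity_arg_le {L : ℕ} (hL : 0 < L) {u : ℂ} (hu : ‖u‖ = 1) :
    ∃ θ : ℝ, |θ| ≤ Real.pi / L ∧
      ∃ ζ ∈ Polynomial.nthRootsFinset L (1 : ℂ), u * ζ = Complex.exp (θ * Complex.I) := by
  have hLR : (0 : ℝ) < L := by exact_mod_cast hL
  have hLC : (L : ℂ) ≠ 0 := by exact_mod_cast hL.ne'
  have hpi := Real.pi_pos
  set k : ℤ := round (Complex.arg u * L / (2 * Real.pi)) with hk
  refine ⟨Complex.arg u - 2 * Real.pi * k / L, ?_, Complex.exp (-(2 * Real.pi * k / L) * Complex.I),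
    ?_, ?_⟩
  · have h := abs_sub_round (Complex.arg u * L / (2 * Real.pi))
    rw [← hk] at h
    have he : Complex.arg u - 2 * Real.pi * k / L =
        (2 * Real.pi / L) * (Complex.arg u * L / (2 * Real.pi) - k) := by
      field_simp
    rw [he, abs_mul, abs_of_pos (by positivity)]
    calc _ ≤ 2 * Real.pi / L * (1 / 2) := by gcongr
      _ = _ := by ring
  · rw [Polynomial.mem_nthRootsFinset hL, ← Complex.exp_nat_mul, Complex.exp_eq_one_iff]
    refine ⟨-k, ?_⟩
    push_cast
    field_simp
  · nth_rewrite 1 [← Complex.norm_mul_exp_arg_mul_I u]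
    rw [hu, Complex.ofReal_one, one_mul, ← Complex.exp_add]
    congr 1
    push_cast
    ring

/-- A function bounded by `K` on the unit circle and small on a short arc is small at the centre. -/
theorem exists_arc_le_norm {h : ℂ → ℂ} (hc : ContinuousOn h (Metric.closedBall 0 1))
    (hd : DifferentiableOn ℂ h (Metric.ball 0 1)) {K : ℝ} (hK : ∀ u, ‖u‖ = 1 → ‖h u‖ ≤ K)
    {L : ℕ} (hL : 0 < L) :
    ∃ θ : ℝ, |θ| ≤ Real.pi / L ∧
      ‖h 0‖ ^ L ≤ ‖h (Complex.exp (θ * Complex.I))‖ * K ^ (L - 1) := by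
  have hexp : ∀ θ : ℝ, ‖Complex.exp (θ * Complex.I)‖ = 1 := Complex.norm_exp_ofReal_mul_I
  have hK0 : 0 ≤ K := (norm_nonneg _).trans (hK 1 norm_one)
  obtain ⟨θ, hθ, hmax⟩ := (isCompact_Icc (a := -(Real.pi / L)) (b := Real.pi / L)).exists_isMaxOn
    (f := fun θ : ℝ => ‖h (Complex.exp (θ * Complex.I))‖)
    (Set.nonempty_Icc.2 (by have : 0 ≤ Real.pi / L := by positivity
                            linarith))
    (ContinuousOn.norm (hc.comp (by fun_prop) fun θ _ => by simp [hexp]))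
  refine ⟨θ, abs_le.2 hθ, ?_⟩
  set R := Polynomial.nthRootsFinset L (1 : ℂ) with hR
  have hcard : R.card = L := (Complex.isPrimitiveRoot_exp L hL.ne').card_nthRootsFinset
  have hnorm : ∀ ζ ∈ R, ‖ζ‖ = 1 := fun ζ hζ => by
    rw [Polynomial.mem_nthRootsFinset hL] at hζ
    exact Complex.norm_eq_one_of_pow_eq_one hζ hL.ne'
  -- At `0` this product is `h 0 ^ L`. On the circle one factor is evaluated in the arc, and the
  -- other `L - 1` are at most `K`.
  have hdc : DiffContOnCl ℂ (fun u => ∏ ζ ∈ R, h (u * ζ)) (Metric.ball 0 1) := by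
    constructor
    · refine DifferentiableOn.fun_finsetProd fun ζ hζ => hd.comp (by fun_prop) fun u hu => ?_
      simpa [hnorm ζ hζ] using hu
    · rw [closure_ball _ one_ne_zero]
      refine continuousOn_finsetProd _ fun ζ hζ => hc.comp (by fun_prop) fun u hu => ?_
      simpa [hnorm ζ hζ] using hu
  have key := Complex.norm_le_of_forall_mem_frontier_norm_le Metric.isBounded_ball hdc
    (C := ‖h (Complex.exp (θ * Complex.I))‖ * K ^ (L - 1)) (z := 0) ?_
    (subset_closure (by simp))
  · simpa [hcard] using key
  · intro u hu
    rw [frontier_ball _ one_ne_zero, mem_sphere_zero_iff_norm] at hu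
    obtain ⟨φ, hφ, ζ, hζ, huζ⟩ := exists_root_of_unity_arg_le hL hu
    rw [norm_prod, ← Finset.mul_prod_erase R _ hζ]
    refine mul_le_mul ?_ ?_ (by positivity) (norm_nonneg _)
    · rw [huζ]
      exact hmax (abs_le.1 hφ)
    · rw [← hcard, ← Finset.card_erase_of_mem hζ, ← Finset.prod_const]
      refine Finset.prod_le_prod (fun _ _ => norm_nonneg _) fun ξ hξ => hK _ ?_
      rw [norm_mul, hu, hnorm ξ (Finset.mem_of_mem_erase hξ), one_mul]

end ArcBound

/-! ### Compactness of signed power series -/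

section Compactness

/-- Power series with coefficients in `{-1, 0, 1}` and nonzero constant term are not uniformly
small on a set that accumulates inside the unit disc. -/
theorem exists_lower_bound_signed_series {I : Set ℂ} (hI : ∀ w ∈ I, ‖w‖ < 1) {w₀ : ℂ}
    (hw₀ : ‖w₀‖ < 1) (hacc : ∃ᶠ w in nhdsWithin w₀ {w₀}ᶜ, w ∈ I) :
    ∃ δ : ℝ, 0 < δ ∧ ∀ b : ℕ → ℤ, (∀ j, b j ∈ ({-1, 0, 1} : Set ℤ)) → b 0 ≠ 0 →
      ∃ w ∈ I, δ ≤ ‖∑' j, (b j : ℂ) * w ^ j‖ := by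
  -- A product of finite sets, hence compact, with the condition `b 0 ≠ 0` built into the first
  -- factor.
  set S : Set (ℕ → ℤ) := Set.univ.pi fun j => if j = 0 then {-1, 1} else {-1, 0, 1} with hS
  have hSc : IsCompact S := isCompact_univ_pi fun j => by
    split_ifs
    · exact (Set.toFinite _).isCompact
    · exact (Set.toFinite _).isCompact
  have hSb : ∀ b ∈ S, ∀ j, ‖(b j : ℂ)‖ ≤ 1 := by
    intro b hb j
    have := hb j (Set.mem_univ j)
    by_cases hj : j = 0
    · simp only [hj, if_true, Set.mem_insert_iff, Set.mem_singleton_iff] at this ⊢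
      rcases this with h | h <;> simp [h]
    · simp only [hj, if_false, Set.mem_insert_iff, Set.mem_singleton_iff] at this
      rcases this with h | h | h <;> simp [h]
  have hP : ∃ δ : ℝ, 0 < δ ∧ ∀ b ∈ S, ∃ w ∈ I, δ ≤ ‖∑' j, (b j : ℂ) * w ^ j‖ := by
    -- The property passes to subsets and finite unions, so a bound in a neighbourhood of each `b`
    -- suffices.
    refine hSc.induction_on (p := fun s => ∃ δ : ℝ, 0 < δ ∧ ∀ b ∈ s, ∃ w ∈ I,
      δ ≤ ‖∑' j, (b j : ℂ) * w ^ j‖) ⟨1, one_pos, by simp⟩ ?_ ?_ ?_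
    · rintro s t hst ⟨δ, hδ, h⟩
      exact ⟨δ, hδ, fun b hb => h b (hst hb)⟩
    · rintro s t ⟨δ, hδ, h⟩ ⟨δ', hδ', h'⟩
      refine ⟨min δ δ', lt_min hδ hδ', ?_⟩
      rintro b (hb | hb)
      · obtain ⟨w, hw, hle⟩ := h b hb
        exact ⟨w, hw, (min_le_left _ _).trans hle⟩
      · obtain ⟨w, hw, hle⟩ := h' b hb
        exact ⟨w, hw, (min_le_right _ _).trans hle⟩
    · intro b hb
      obtain ⟨w, hw, hne⟩ : ∃ w ∈ I, ∑' j, (b j : ℂ) * w ^ j ≠ 0 := by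
        by_contra! hzero
        have han : AnalyticOnNhd ℂ (fun w : ℂ => ∑' j, (b j : ℂ) * w ^ j) (Metric.ball 0 1) := by
          refine DifferentiableOn.analyticOnNhd ?_ Metric.isOpen_ball
          intro w hw
          obtain ⟨r, hr, hr1⟩ := exists_between (mem_ball_zero_iff.1 hw)
          have hr0 : 0 ≤ r := (norm_nonneg w).trans hr.le
          refine DifferentiableAt.differentiableWithinAt
            (DifferentiableOn.differentiableAt (s := Metric.ball 0 r) ?_
              (Metric.isOpen_ball.mem_nhds (by simpa using hr)))
          refine Complex.differentiableOn_tsum_of_summable_norm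
            (summable_geometric_of_lt_one hr0 hr1) (fun j => by fun_prop) Metric.isOpen_ball ?_
          intro j v hv
          rw [norm_mul, norm_pow]
          calc _ ≤ 1 * r ^ j := by
                gcongr
                · exact hSb b hb j
                · exact (mem_ball_zero_iff.1 hv).le
            _ = r ^ j := one_mul _
        -- A series vanishing on `I` has zeros accumulating at `w₀`, so it vanishes on the disc, in
        -- particular at `0`, where its value is `b 0`.
        have h0 := han.eqOn_zero_of_preconnected_of_frequently_eq_zero
          (convex_ball 0 1).isPreconnected (mem_ball_zero_iff.2 hw₀)
          (hacc.mono fun w hw => hzero w hw) (Metric.mem_ball_self one_pos)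
        have : (b 0 : ℂ) = 0 := by
          refine Eq.trans ?_ h0
          simp only
          rw [tsum_eq_single 0 (by intro j hj; simp [hj])]
          simp
        have hb0 := hb 0 (Set.mem_univ 0)
        simp only [if_true, Set.mem_insert_iff, Set.mem_singleton_iff] at hb0
        rcases hb0 with h | h <;> simp [h] at this
      have hcont : ContinuousOn (fun b : ℕ → ℤ => ∑' j, (b j : ℂ) * w ^ j) S := by
        refine continuousOn_tsum (u := fun j => ‖w‖ ^ j) (fun j => ?_)
          (summable_geometric_of_lt_one (norm_nonneg w) (hI w hw)) ?_
        · refine Continuous.continuousOn (Continuous.mul ?_ continuous_const)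
          exact (continuous_of_discreteTopology (f := fun k : ℤ => (k : ℂ))).comp
            (continuous_apply j)
        · intro j c hc
          rw [norm_mul, norm_pow]
          exact mul_le_of_le_one_left (by positivity) (hSb c hc j)
      refine ⟨_, Filter.Eventually.filter_mono le_rfl ((hcont b hb).norm.eventually
        (lt_mem_nhds (half_lt_self (norm_pos_iff.2 hne)))), _, half_pos (norm_pos_iff.2 hne), ?_⟩
      exact fun c hc => ⟨w, hw, le_of_lt hc⟩
  obtain ⟨δ, hδ, h⟩ := hP
  refine ⟨δ, hδ, fun b hb hb0 => h b fun j _ => ?_⟩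
  by_cases hj : j = 0
  · subst hj
    have := hb 0
    simp only [Set.mem_insert_iff, Set.mem_singleton_iff] at this
    simp only [if_true, Set.mem_insert_iff, Set.mem_singleton_iff]
    tauto
  · simpa [hj] using hb j

end Compactness

/-! ### Estimates near `1` and real parts of expectations -/

section PowerBounds

theorem norm_pow_sub_one_le {z : ℂ} (hz : ‖z‖ ≤ 1) (m : ℕ) : ‖z ^ m - 1‖ ≤ m * ‖z - 1‖ := by
  induction m with
  | zero => simp
  | succ m ih =>
    have : z ^ (m + 1) - 1 = z * (z ^ m - 1) + (z - 1) := by ring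
    rw [this]
    refine (norm_add_le _ _).trans ?_
    rw [norm_mul]
    have h := mul_le_mul hz ih (norm_nonneg _) zero_le_one
    push_cast
    linarith

theorem norm_pow_sub_linear_le {z : ℂ} (hz : ‖z‖ ≤ 1) (m : ℕ) :
    ‖z ^ m - 1 - m * (z - 1)‖ ≤ (m : ℝ) ^ 2 * ‖z - 1‖ ^ 2 := by
  induction m with
  | zero => simp
  | succ m ih =>
    have : z ^ (m + 1) - 1 - ((m + 1 : ℕ) : ℂ) * (z - 1) =
        z * (z ^ m - 1 - m * (z - 1)) + m * (z - 1) ^ 2 := by push_cast; ring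
    rw [this]
    refine (norm_add_le _ _).trans ?_
    rw [norm_mul, norm_mul, norm_pow, Complex.norm_natCast]
    have h := mul_le_mul hz ih (norm_nonneg _) zero_le_one
    have h2 : 0 ≤ ‖z - 1‖ ^ 2 := by positivity
    push_cast
    nlinarith [mul_nonneg (Nat.cast_nonneg (α := ℝ) m) h2]

/-- The linear term `m (z - 1)` enters only through its real part. On a circle tangent at `1` the
bound is therefore quadratic in the angle, which `norm_pow_sub_one_le` would not give. -/
theorem one_sub_re_pow_le {z : ℂ} (hz : ‖z‖ ≤ 1) (m : ℕ) :
    1 - (z ^ m).re ≤ (m : ℝ) ^ 2 * ((1 - z.re) + ‖z - 1‖ ^ 2) := by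
  have h := (Complex.abs_re_le_norm _).trans (norm_pow_sub_linear_le hz m)
  have h1 := (abs_le.1 h).1
  simp only [Complex.sub_re, Complex.mul_re, Complex.one_re, Complex.natCast_re,
    Complex.natCast_im, zero_mul, sub_zero] at h1
  have hre : 0 ≤ 1 - z.re := by linarith [(Complex.re_le_norm z).trans hz]
  have hm : (m : ℝ) ≤ (m : ℝ) ^ 2 := by
    rcases Nat.eq_zero_or_pos m with rfl | hm
    · simp
    · have : (1 : ℝ) ≤ m := by exact_mod_cast hm
      nlinarith
  nlinarith [mul_le_mul_of_nonneg_right hm hre]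

end PowerBounds

section RealMean

variable {α : Type*}

theorem summable_toReal (p : PMF α) : Summable fun a => (p a).toReal :=
  ENNReal.summable_toReal (by rw [p.tsum_coe]; exact ENNReal.one_ne_top)

theorem tsum_toReal (p : PMF α) : ∑' a, (p a).toReal = 1 := by
  rw [← ENNReal.tsum_toReal_eq p.apply_ne_top, p.tsum_coe, ENNReal.toReal_one]

theorem re_mean {p : PMF α} {f : α → ℂ} (h : lexp p (fun a => ‖f a‖ₑ) ≠ ⊤) :
    (mean p f).re = ∑' a, (p a).toReal * (f a).re := by
  rw [mean, Complex.re_tsum (summable_mean h)]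
  simp

theorem summable_re_mean {p : PMF α} {f : α → ℂ} (h : lexp p (fun a => ‖f a‖ₑ) ≠ ⊤) :
    Summable fun a => (p a).toReal * (f a).re := by
  simpa using (Complex.hasSum_re (summable_mean h).hasSum).summable

theorem exists_apply_ne_zero {p : PMF α} {s : Set α} (h : 0 < p.toOuterMeasure s) :
    ∃ a ∈ s, 0 < (p a).toReal := by
  by_contra! hs
  refine h.ne' ((PMF.toOuterMeasure_apply_eq_zero_iff p s).2 ?_)
  rw [Set.disjoint_left]
  intro a ha has
  exact ha ((ENNReal.toReal_eq_zero_iff _).1 (le_antisymm (hs a has) ENNReal.toReal_nonneg)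
    |>.resolve_right (p.apply_ne_top a))

end RealMean

/-! ### Analytic properties of the two generating functions -/

namespace ReplicationInsertionChannel

variable (ch : ReplicationInsertionChannel)

theorem lexp_enorm_pow_ne_top {z : ℂ} (hz : ‖z‖ ≤ 1) :
    lexp ch.law (fun a => ‖z ^ a.1‖ₑ) ≠ ⊤ :=
  lexp_enorm_ne_top_of_bounded _ (C := 1) fun a => by
    simpa using pow_le_one₀ (norm_nonneg z) hz

theorem norm_term_lengthGen_le {z : ℂ} (hz : ‖z‖ ≤ 1) (a : Σ m : ℕ, Finset (Fin m)) :
    ‖((ch.law a).toReal : ℂ) * z ^ a.1‖ ≤ (ch.law a).toReal := by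
  rw [norm_mul, norm_pow, Complex.norm_real, Real.norm_of_nonneg ENNReal.toReal_nonneg]
  exact mul_le_of_le_one_right ENNReal.toReal_nonneg (pow_le_one₀ (norm_nonneg _) hz)

theorem continuousOn_lengthGen : ContinuousOn ch.lengthGen (Metric.closedBall 0 1) :=
  continuousOn_tsum (fun _ => by fun_prop) (summable_toReal ch.law)
    fun a z hz => ch.norm_term_lengthGen_le (by simpa using hz) a

theorem differentiableOn_lengthGen : DifferentiableOn ℂ ch.lengthGen (Metric.ball 0 1) :=
  Complex.differentiableOn_tsum_of_summable_norm (summable_toReal ch.law)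
    (fun _ => by fun_prop) Metric.isOpen_ball
    fun a z hz => ch.norm_term_lengthGen_le (by simpa using (mem_ball_zero_iff.1 hz).le) a

/-- A single atom of mass `q` with positive length already gives this slack, since there `‖z‖ ^ m ≤
‖z‖`. -/
theorem exists_norm_lengthGen_le :
    ∃ q : ℝ, 0 < q ∧ ∀ z : ℂ, ‖z‖ ≤ 1 → ‖ch.lengthGen z‖ ≤ 1 - q * (1 - ‖z‖) := by
  obtain ⟨a₀, ha₀, hpos⟩ := exists_apply_ne_zero ch.length_pos
  refine ⟨(ch.law a₀).toReal, hpos, fun z hz => ?_⟩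
  classical
  have hs : Summable fun a => ‖((ch.law a).toReal : ℂ) * z ^ a.1‖ :=
    Summable.of_nonneg_of_le (fun _ => norm_nonneg _) (ch.norm_term_lengthGen_le hz)
      (summable_toReal ch.law)
  have hone : Summable fun a => if a = a₀ then (ch.law a₀).toReal * (1 - ‖z‖) else 0 :=
    (hasSum_ite_eq a₀ _).summable
  refine (norm_tsum_le_tsum_norm hs).trans ?_
  have hr : 1 - (ch.law a₀).toReal * (1 - ‖z‖) =
      ∑' a, ((ch.law a).toReal - if a = a₀ then (ch.law a₀).toReal * (1 - ‖z‖) else 0) := by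
    rw [(summable_toReal _).tsum_sub hone, tsum_toReal, tsum_ite_eq]
  rw [hr]
  refine hs.tsum_le_tsum (fun a => ?_) ((summable_toReal _).sub hone)
  by_cases h : a = a₀
  · subst h
    rw [norm_mul, norm_pow, Complex.norm_real, Real.norm_of_nonneg ENNReal.toReal_nonneg,
      if_pos rfl]
    have := pow_le_of_le_one (norm_nonneg z) hz (Nat.pos_iff_ne_zero.1 ha₀)
    nlinarith
  · simpa [h] using ch.norm_term_lengthGen_le hz a

/-- The generating function is strictly increasing on `[0, 1]`, because some positive length has
positive mass. Hence its values accumulate at the value at `1 / 2` without being equal to it. -/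
theorem lengthGen_ofReal_ne {s t : ℝ} (hs : 0 ≤ s) (hst : s < t) (ht : t ≤ 1) :
    ch.lengthGen s ≠ ch.lengthGen t := by
  obtain ⟨a₀, ha₀, hpos⟩ := exists_apply_ne_zero ch.length_pos
  have hns : ‖(s : ℂ)‖ ≤ 1 := by
    rw [Complex.norm_real, Real.norm_of_nonneg hs]; linarith
  have hnt : ‖(t : ℂ)‖ ≤ 1 := by
    rw [Complex.norm_real, Real.norm_of_nonneg (by linarith)]; linarith
  have hre : (ch.lengthGen s).re < (ch.lengthGen t).re := by
    rw [lengthGen, lengthGen, re_mean (ch.lexp_enorm_pow_ne_top hns),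
      re_mean (ch.lexp_enorm_pow_ne_top hnt)]
    refine Summable.tsum_lt_tsum (i := a₀) (fun a => ?_) ?_
      (summable_re_mean (ch.lexp_enorm_pow_ne_top hns))
      (summable_re_mean (ch.lexp_enorm_pow_ne_top hnt))
    · simp only [← Complex.ofReal_pow, Complex.ofReal_re]
      gcongr
    · simp only [← Complex.ofReal_pow, Complex.ofReal_re]
      have : s ^ a₀.1 < t ^ a₀.1 := pow_lt_pow_left₀ hst hs (Nat.pos_iff_ne_zero.1 ha₀)
      gcongr
  exact fun h => hre.ne (by rw [h])

theorem lexp_length_ne_top (hM : lexp ch.law (fun a => (a.1 : ℝ≥0∞) ^ 2) ≠ ⊤) :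
    lexp ch.law (fun a => (a.1 : ℝ≥0∞)) ≠ ⊤ := by
  refine ne_top_of_le_ne_top hM (lexp_mono _ fun a => ?_)
  exact_mod_cast Nat.le_self_pow two_ne_zero a.1

theorem summable_sq_length (hM : lexp ch.law (fun a => (a.1 : ℝ≥0∞) ^ 2) ≠ ⊤) :
    Summable fun a => (ch.law a).toReal * (a.1 : ℝ) ^ 2 := by
  simpa using ENNReal.summable_toReal hM

theorem one_sub_le_norm_lengthGen (hM : lexp ch.law (fun a => (a.1 : ℝ≥0∞) ^ 2) ≠ ⊤) {z : ℂ}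
    (hz : ‖z‖ ≤ 1) :
    1 - (lexp ch.law fun a => (a.1 : ℝ≥0∞) ^ 2).toReal * ((1 - z.re) + ‖z - 1‖ ^ 2) ≤
      ‖ch.lengthGen z‖ := by
  refine le_trans ?_ (Complex.re_le_norm _)
  rw [lengthGen, re_mean (ch.lexp_enorm_pow_ne_top hz), lexp, ENNReal.tsum_toReal_eq
    (ENNReal.ne_top_of_tsum_ne_top hM), ← tsum_mul_right, sub_le_iff_le_add]
  simp only [ENNReal.toReal_mul, ENNReal.toReal_pow, ENNReal.toReal_natCast]
  have h1 := (ch.summable_sq_length hM).mul_right ((1 - z.re) + ‖z - 1‖ ^ 2)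
  have h2 := summable_re_mean (ch.lexp_enorm_pow_ne_top hz)
  rw [← h2.tsum_add h1]
  refine (tsum_toReal ch.law).symm.le.trans ?_
  refine (summable_toReal _).tsum_le_tsum (fun a => ?_) (h2.add h1)
  have := mul_le_mul_of_nonneg_left (one_sub_re_pow_le hz a.1)
    (ENNReal.toReal_nonneg (a := ch.law a))
  linarith

theorem norm_sum_pow_le {z : ℂ} (hz : ‖z‖ ≤ 1) {m : ℕ} (s : Finset (Fin m)) :
    ‖∑ j ∈ s, z ^ (j : ℕ)‖ ≤ m := by
  refine (norm_sum_le_of_le s (n := fun _ => 1) fun j _ => ?_).trans ?_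
  · rw [norm_pow]
    exact pow_le_one₀ (norm_nonneg _) hz
  · simpa using s.card_le_univ

theorem lexp_enorm_sum_pow_ne_top (hM : lexp ch.law (fun a => (a.1 : ℝ≥0∞)) ≠ ⊤) {z : ℂ}
    (hz : ‖z‖ ≤ 1) : lexp ch.law (fun a => ‖∑ j ∈ a.2, z ^ (j : ℕ)‖ₑ) ≠ ⊤ := by
  refine ne_top_of_le_ne_top hM (lexp_mono _ fun a => ?_)
  rw [← ofReal_norm, ← ENNReal.ofReal_natCast]
  exact ENNReal.ofReal_le_ofReal (norm_sum_pow_le hz a.2)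

theorem norm_replicationGen_sub_le (hM : lexp ch.law (fun a => (a.1 : ℝ≥0∞) ^ 2) ≠ ⊤) {z : ℂ}
    (hz : ‖z‖ ≤ 1) :
    ‖ch.replicationGen z - ch.replicationGen 1‖ ≤
      (lexp ch.law fun a => (a.1 : ℝ≥0∞) ^ 2).toReal * ‖z - 1‖ := by
  have hM1 := ch.lexp_length_ne_top hM
  rw [replicationGen, replicationGen, ← mean_sub (ch.lexp_enorm_sum_pow_ne_top hM1 hz)
    (ch.lexp_enorm_sum_pow_ne_top hM1 norm_one.le), ← ENNReal.ofReal_le_ofReal_iff (by positivity),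
    ofReal_norm]
  refine (enorm_mean_le _ _).trans ?_
  rw [ENNReal.ofReal_mul ENNReal.toReal_nonneg, ENNReal.ofReal_toReal hM, ← lexp_mul_const]
  refine lexp_mono _ fun a => ?_
  rw [← ofReal_norm, ← Finset.sum_sub_distrib, ← ENNReal.ofReal_natCast,
    ← ENNReal.ofReal_pow (by positivity), ← ENNReal.ofReal_mul (by positivity)]
  refine ENNReal.ofReal_le_ofReal ?_
  refine (norm_sum_le_of_le a.2 (n := fun _ => (a.1 : ℝ) * ‖z - 1‖) fun j _ => ?_).trans ?_
  · rw [one_pow]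
    refine (norm_pow_sub_one_le hz j).trans ?_
    gcongr
    exact j.2.le
  · rw [Finset.sum_const, nsmul_eq_mul, sq, mul_assoc]
    gcongr
    simpa using a.2.card_le_univ

/-- The value at `1` is the expected number of replicated positions. -/
theorem norm_replicationGen_one_pos (hM : lexp ch.law (fun a => (a.1 : ℝ≥0∞)) ≠ ⊤) :
    0 < ‖ch.replicationGen 1‖ := by
  obtain ⟨a₀, ha₀, hpos⟩ := exists_apply_ne_zero ch.replications_nonempty
  refine lt_of_lt_of_le ?_ (Complex.re_le_norm _)
  have h := ch.lexp_enorm_sum_pow_ne_top hM norm_one.le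
  rw [replicationGen, re_mean h]
  refine (summable_re_mean h).tsum_pos (fun a => ?_) a₀ ?_
  · simp only [one_pow, Finset.sum_const, nsmul_eq_mul, mul_one, Complex.natCast_re]
    positivity
  · simp only [one_pow, Finset.sum_const, nsmul_eq_mul, mul_one, Complex.natCast_re]
    have : (0 : ℝ) < a₀.2.card := by exact_mod_cast Finset.card_pos.2 ha₀
    positivity

/-- Signed series composed with the length generating function are not uniformly small on
`[1/4, 3/4]`. -/
theorem exists_lower_bound_lengthGen :
    ∃ δ : ℝ, 0 < δ ∧ ∀ b : ℕ → ℤ, (∀ j, b j ∈ ({-1, 0, 1} : Set ℤ)) → b 0 ≠ 0 →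
      ∃ s ∈ Set.Icc (1 / 4 : ℝ) (3 / 4), δ ≤ ‖∑' j, (b j : ℂ) * ch.lengthGen s ^ j‖ := by
  obtain ⟨q, hq, hg⟩ := ch.exists_norm_lengthGen_le
  have hlt : ∀ s ∈ Set.Icc (1 / 4 : ℝ) (3 / 4), ‖ch.lengthGen s‖ < 1 := by
    intro s hs
    have hn : ‖(s : ℂ)‖ = s := by
      rw [Complex.norm_real, Real.norm_of_nonneg (by linarith [hs.1])]
    have := hg s (by rw [hn]; linarith [hs.2])
    rw [hn] at this
    nlinarith [hs.2]
  have hacc : ∃ᶠ w in nhdsWithin (ch.lengthGen (1 / 2 : ℝ)) {ch.lengthGen (1 / 2 : ℝ)}ᶜ,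
      w ∈ (fun s : ℝ => ch.lengthGen s) '' Set.Icc (1 / 4 : ℝ) (3 / 4) := by
    have ht : Filter.Tendsto (fun s : ℝ => ch.lengthGen s) (nhdsWithin (1 / 2) (Set.Ioi (1 / 2)))
        (nhdsWithin (ch.lengthGen (1 / 2 : ℝ)) {ch.lengthGen (1 / 2 : ℝ)}ᶜ) := by
      refine tendsto_nhdsWithin_iff.2 ⟨?_, ?_⟩
      · have hc : ContinuousAt ch.lengthGen ((1 / 2 : ℝ) : ℂ) :=
          ch.continuousOn_lengthGen.continuousAt
            (Metric.closedBall_mem_nhds_of_mem (by rw [mem_ball_zero_iff, Complex.norm_real]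
                                                   norm_num))
        exact (hc.tendsto.comp (Complex.continuous_ofReal.tendsto _)).mono_left
          nhdsWithin_le_nhds
      · filter_upwards [Ioo_mem_nhdsGT (show (1 / 2 : ℝ) < 3 / 4 by norm_num)] with s hs
        exact (ch.lengthGen_ofReal_ne (by norm_num) hs.1 (by linarith [hs.2])).symm
    refine ht.frequently (Filter.Eventually.frequently ?_)
    filter_upwards [Ioo_mem_nhdsGT (show (1 / 2 : ℝ) < 3 / 4 by norm_num)] with s hs
    exact ⟨s, ⟨by linarith [hs.1], hs.2.le⟩, rfl⟩
  obtain ⟨δ, hδ, h⟩ := exists_lower_bound_signed_series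
    (I := (fun s : ℝ => ch.lengthGen s) '' Set.Icc (1 / 4 : ℝ) (3 / 4))
    (w₀ := ch.lengthGen (1 / 2 : ℝ)) (by rintro _ ⟨s, hs, rfl⟩; exact hlt s hs)
    (hlt _ ⟨by norm_num, by norm_num⟩) hacc
  refine ⟨δ, hδ, fun b hb hb0 => ?_⟩
  obtain ⟨_, ⟨s, hs, rfl⟩, hle⟩ := h b hb hb0
  exact ⟨s, hs, hle⟩

end ReplicationInsertionChannel

/-! ### Signed polynomials and tangent circles -/

/-- The difference of two sign sequences is twice a monomial times a polynomial with coefficients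
in `{-1, 0, 1}` and nonzero constant term. -/
theorem exists_signed_coeffs {n : ℕ} {x x' : Fin n → ℤˣ} (h : x ≠ x') :
    ∃ (k N : ℕ) (b : ℕ → ℤ), k ≤ n ∧ (∀ j, b j ∈ ({-1, 0, 1} : Set ℤ)) ∧ b 0 ≠ 0 ∧
      (∀ j, N ≤ j → b j = 0) ∧
      ∀ w : ℂ, ∑ i : Fin n, (((x i : ℤ) : ℂ) - ((x' i : ℤ) : ℂ)) * w ^ (i : ℕ) =
        2 * (w ^ k * ∑ j ∈ Finset.range N, (b j : ℂ) * w ^ j) := by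
  set a : ℕ → ℤ := fun j => if hj : j < n then ((x ⟨j, hj⟩ : ℤ) - (x' ⟨j, hj⟩ : ℤ)) / 2 else 0
    with ha
  have ha2 : ∀ i : Fin n, (a i : ℤ) * 2 = (x i : ℤ) - (x' i : ℤ) := fun i => by
    simp only [ha, i.2, dif_pos]
    rcases Int.units_eq_one_or (x i) with h1 | h1 <;>
      rcases Int.units_eq_one_or (x' i) with h2 | h2 <;> simp [h1, h2]
  have hmem : ∀ j, a j ∈ ({-1, 0, 1} : Set ℤ) := fun j => by
    by_cases hj : j < n
    · simp only [ha, hj, dif_pos]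
      rcases Int.units_eq_one_or (x ⟨j, hj⟩) with h1 | h1 <;>
        rcases Int.units_eq_one_or (x' ⟨j, hj⟩) with h2 | h2 <;> simp [h1, h2]
    · simp [ha, hj]
  have hex : ∃ j, a j ≠ 0 := by
    obtain ⟨i, hi⟩ := Function.ne_iff.1 h
    refine ⟨i, fun h0 => hi ?_⟩
    have := ha2 i
    rw [h0, zero_mul] at this
    exact Units.ext (sub_eq_zero.1 this.symm)
  have hzero : ∀ j, n ≤ j → a j = 0 := fun j hj => by simp [ha, hj.not_gt]
  have hk : Nat.find hex ≤ n := by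
    by_contra! hlt
    exact Nat.find_spec hex (hzero _ hlt.le)
  -- The exponent `k` is the first index at which the strings differ.
  refine ⟨Nat.find hex, n - Nat.find hex, fun j => a (Nat.find hex + j), hk, fun j => hmem _,
    Nat.find_spec hex, fun j hj => hzero _ (by omega), fun w => ?_⟩
  have h1 : ∑ i : Fin n, (((x i : ℤ) : ℂ) - ((x' i : ℤ) : ℂ)) * w ^ (i : ℕ) =
      2 * ∑ i ∈ Finset.range n, (a i : ℂ) * w ^ i := by
    rw [Finset.sum_range, Finset.mul_sum]
    refine Finset.sum_congr rfl fun i _ => ?_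
    rw [← Int.cast_sub, ← ha2 i]
    push_cast
    ring
  rw [h1]
  congr 1
  conv_lhs => rw [← Nat.add_sub_cancel' hk, Finset.sum_range_add]
  rw [Finset.sum_eq_zero, zero_add, Finset.mul_sum]
  · exact Finset.sum_congr rfl fun j _ => by rw [pow_add]; ring
  · intro j hj
    have : a j = 0 := by
      by_contra h0
      exact Nat.find_min hex (Finset.mem_range.1 hj) h0
    simp [this]

theorem norm_signed_sum_mul_le {b : ℕ → ℤ} (hb : ∀ j, b j ∈ ({-1, 0, 1} : Set ℤ)) {w : ℂ}
    (hw : ‖w‖ ≤ 1) (N : ℕ) :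
    ‖∑ j ∈ Finset.range N, (b j : ℂ) * w ^ j‖ * (1 - ‖w‖) ≤ 1 := by
  have h1 : ‖∑ j ∈ Finset.range N, (b j : ℂ) * w ^ j‖ ≤ ∑ j ∈ Finset.range N, ‖w‖ ^ j := by
    refine norm_sum_le_of_le _ fun j _ => ?_
    rw [norm_mul, norm_pow]
    refine mul_le_of_le_one_left (by positivity) ?_
    have := hb j
    simp only [Set.mem_insert_iff, Set.mem_singleton_iff] at this
    rcases this with h | h | h <;> simp [h]
  calc _ ≤ (∑ j ∈ Finset.range N, ‖w‖ ^ j) * (1 - ‖w‖) := by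
        gcongr
    _ = 1 - ‖w‖ ^ N := geom_sum_mul_neg _ _
    _ ≤ 1 := by linarith [pow_nonneg (norm_nonneg w) N]

/-- Points of the circle with centre `s` through `1` stay away from the unit circle. -/
theorem norm_tangent_circle_le {s : ℝ} (hs : s ∈ Set.Icc (1 / 4 : ℝ) (3 / 4)) {u : ℂ}
    (hu : ‖u‖ = 1) : ‖(s : ℂ) + (1 - s) * u‖ ≤ 1 - 3 / 32 * ‖1 - u‖ ^ 2 := by
  have hu2 : u.re ^ 2 + u.im ^ 2 = 1 := by
    have := Complex.sq_norm u
    rw [hu, Complex.normSq_apply] at this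
    linarith
  have hd : ‖1 - u‖ ^ 2 = 2 * (1 - u.re) := by
    rw [Complex.sq_norm, Complex.normSq_apply]
    simp only [Complex.sub_re, Complex.one_re, Complex.sub_im, Complex.one_im]
    linarith
  have hre : -1 ≤ u.re := by nlinarith [sq_nonneg u.im]
  have hre' : u.re ≤ 1 := by nlinarith [sq_nonneg u.im]
  have hz : ‖(s : ℂ) + (1 - s) * u‖ ^ 2 = 1 - 2 * (s * (1 - s)) * (1 - u.re) := by
    rw [Complex.sq_norm, Complex.normSq_apply]
    simp only [Complex.add_re, Complex.add_im, Complex.mul_re, Complex.mul_im, Complex.sub_re,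
      Complex.sub_im, Complex.one_re, Complex.one_im, Complex.ofReal_re, Complex.ofReal_im]
    linear_combination (1 - s) ^ 2 * hu2
  have hs2 : 3 / 16 ≤ s * (1 - s) := by nlinarith [hs.1, hs.2]
  refine (pow_le_pow_iff_left₀ (norm_nonneg _) ?_ two_ne_zero).1 ?_
  · rw [hd]
    linarith
  · rw [hz, hd]
    nlinarith [mul_nonneg (sub_nonneg.2 hs2) (sub_nonneg.2 hre'), sq_nonneg (1 - u.re)]

theorem norm_convex_comb_le {s : ℝ} (hs : s ∈ Set.Icc (1 / 4 : ℝ) (3 / 4)) {u : ℂ} :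
    ‖(s : ℂ) + (1 - s) * u‖ ≤ s + (1 - s) * ‖u‖ := by
  refine (norm_add_le _ _).trans_eq ?_
  have h : (1 : ℂ) - s = ((1 - s : ℝ) : ℂ) := by push_cast; rfl
  rw [norm_mul, h, Complex.norm_real, Complex.norm_real, Real.norm_of_nonneg (by linarith [hs.1]),
    Real.norm_of_nonneg (by linarith [hs.2])]

/-! ### Separation of mean traces -/

namespace ReplicationInsertionChannel

variable (ch : ReplicationInsertionChannel)

/-- On a short arc tangent to the unit circle at `1`, a signed polynomial in the length generating
function is at least exponentially small in the inverse arc length. -/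
theorem exists_arc_lower_bound :
    ∃ r : ℝ, 0 < r ∧ r ≤ 1 ∧ ∀ (b : ℕ → ℤ) (N L : ℕ), (∀ j, b j ∈ ({-1, 0, 1} : Set ℤ)) →
      b 0 ≠ 0 → (∀ j, N ≤ j → b j = 0) → 0 < L →
      ∃ s ∈ Set.Icc (1 / 4 : ℝ) (3 / 4), ∃ θ : ℝ, |θ| ≤ Real.pi / L ∧
        r ^ L / 4 ≤ ‖∑ j ∈ Finset.range N,
          (b j : ℂ) * ch.lengthGen (s + (1 - s) * Complex.exp (θ * Complex.I)) ^ j‖ := by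
  obtain ⟨δ, hδ, hδb⟩ := ch.exists_lower_bound_lengthGen
  obtain ⟨q, hq, hg⟩ := ch.exists_norm_lengthGen_le
  -- The first entry bounds the function on the circle, `1` allows replacing `K ^ (L - 1)` by `K ^
  -- L`, and `δ` makes the ratio `δ / K` at most `1`.
  set K : ℝ := max (32 / (3 * q)) (max 1 δ) with hK
  have hK1 : 1 ≤ K := (le_max_left _ _).trans (le_max_right _ _)
  have hKδ : δ ≤ K := (le_max_right _ _).trans (le_max_right _ _)
  have hK0 : 0 < K := by linarith
  refine ⟨δ / K, by positivity, (div_le_one hK0).2 hKδ, fun b N L hb hb0 hbN hL => ?_⟩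
  obtain ⟨s, hs, hδs⟩ := hδb b hb hb0
  rw [tsum_eq_sum (s := Finset.range N)
    (by intro j hj; simp [hbN j (by simpa using hj)])] at hδs
  set f : ℂ → ℂ := fun u => ∑ j ∈ Finset.range N, (b j : ℂ) * ch.lengthGen (s + (1 - s) * u) ^ j
    with hf
  have hcb : Set.MapsTo (fun u : ℂ => (s : ℂ) + (1 - s) * u) (Metric.closedBall 0 1)
      (Metric.closedBall 0 1) := fun u hu => by
    rw [mem_closedBall_zero_iff] at hu ⊢
    refine (norm_convex_comb_le hs).trans ?_
    nlinarith [hs.2]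
  have hbb : Set.MapsTo (fun u : ℂ => (s : ℂ) + (1 - s) * u) (Metric.ball 0 1)
      (Metric.ball 0 1) := fun u hu => by
    rw [mem_ball_zero_iff] at hu ⊢
    refine (norm_convex_comb_le hs).trans_lt ?_
    nlinarith [hs.2]
  have hgc : ContinuousOn (fun u : ℂ => ch.lengthGen (s + (1 - s) * u)) (Metric.closedBall 0 1) :=
    ch.continuousOn_lengthGen.comp (by fun_prop) hcb
  have hgd : DifferentiableOn ℂ (fun u : ℂ => ch.lengthGen (s + (1 - s) * u))
      (Metric.ball 0 1) :=
    ch.differentiableOn_lengthGen.comp (by fun_prop) hbb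
  -- A signed polynomial at `w` is at most `1 / (1 - ‖w‖)`, and here `1 - ‖w‖` is at least a
  -- multiple of `‖1 - u‖ ^ 2`. The factor `(1 - u) ^ 2` cancels this blow-up at the point of
  -- tangency, uniformly in the degree, and equals `1` at the centre.
  have hbound : ∀ u : ℂ, ‖u‖ = 1 → ‖f u * (1 - u) ^ 2‖ ≤ K := by
    intro u hu
    have hz1 : ‖(s : ℂ) + (1 - s) * u‖ ≤ 1 := by
      simpa using hcb (mem_closedBall_zero_iff.2 hu.le)
    have h1 := hg _ hz1
    have h2 := norm_tangent_circle_le hs hu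
    have h3 := norm_signed_sum_mul_le (w := ch.lengthGen (s + (1 - s) * u)) hb
      (h1.trans (by nlinarith)) N
    refine le_trans ?_ (le_max_left _ _)
    rw [le_div_iff₀ (by positivity), norm_mul, norm_pow]
    have h4 : q * (3 / 32 * ‖1 - u‖ ^ 2) ≤ 1 - ‖ch.lengthGen (s + (1 - s) * u)‖ := by nlinarith
    have h5 := mul_le_mul_of_nonneg_left h4 (norm_nonneg (f u))
    have h6 := h5.trans h3
    linarith
  obtain ⟨θ, hθ, hle⟩ := exists_arc_le_norm (h := fun u => f u * (1 - u) ^ 2)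
    ((continuousOn_finsetSum _ fun j _ => continuousOn_const.mul (hgc.pow j)).mul (by fun_prop))
    ((DifferentiableOn.fun_sum fun j _ => (hgd.pow j).const_mul _).mul (by fun_prop)) hbound hL
  refine ⟨s, hs, θ, hθ, ?_⟩
  have hf0 : δ ≤ ‖f 0 * (1 - 0) ^ 2‖ := by simpa [hf] using hδs
  have hfour : ‖(1 - Complex.exp (θ * Complex.I)) ^ 2‖ ≤ 4 := by
    rw [norm_pow]
    have := norm_sub_le 1 (Complex.exp (θ * Complex.I))
    rw [Complex.norm_exp_ofReal_mul_I, norm_one] at this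
    nlinarith [norm_nonneg (1 - Complex.exp (θ * Complex.I))]
  have h1 : δ ^ L ≤ ‖f (Complex.exp (θ * Complex.I))‖ * 4 * K ^ L := by
    calc δ ^ L ≤ ‖f 0 * (1 - 0) ^ 2‖ ^ L := by gcongr
      _ ≤ _ := hle
      _ ≤ ‖f (Complex.exp (θ * Complex.I))‖ * 4 * K ^ L := by
        rw [norm_mul]
        gcongr
        exact Nat.sub_le L 1
  rw [div_pow, div_div, div_le_iff₀ (by positivity)]
  change _ ≤ ‖f (Complex.exp (θ * Complex.I))‖ * _
  linarith

theorem lengthGen_replicationGen_lower_bound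
    (hM : lexp ch.law (fun a => (a.1 : ℝ≥0∞) ^ 2) ≠ ⊤) :
    ∃ σ θ₀ κ : ℝ, 0 ≤ σ ∧ 0 < θ₀ ∧ 0 < κ ∧
      ∀ s ∈ Set.Icc (1 / 4 : ℝ) (3 / 4), ∀ θ : ℝ, |θ| ≤ θ₀ →
        Real.exp (-(σ * θ ^ 2)) ≤ ‖ch.lengthGen (s + (1 - s) * Complex.exp (θ * Complex.I))‖ ∧
        κ ≤ ‖ch.replicationGen (s + (1 - s) * Complex.exp (θ * Complex.I))‖ := by
  set m2 := (lexp ch.law fun a => (a.1 : ℝ≥0∞) ^ 2).toReal with hm2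
  have hm0 : 0 ≤ m2 := ENNReal.toReal_nonneg
  have hF := ch.norm_replicationGen_one_pos (ch.lexp_length_ne_top hM)
  set F := ‖ch.replicationGen 1‖ with hFdef
  -- The first entry of the minimum gives `2 * m2 * θ ^ 2 ≤ 1 / 2`, where `1 - y ≥ exp (-2 y)`
  -- applies to `y = 2 * m2 * θ ^ 2`; the second keeps the variation of `replicationGen` below `F /
  -- 2`.
  refine ⟨4 * m2, min (1 / (2 * (m2 + 1))) (F / (2 * (m2 + 1))), F / 2, by positivity,
    by positivity, by positivity, fun s hs θ hθ => ?_⟩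
  set z := (s : ℂ) + (1 - s) * Complex.exp (θ * Complex.I) with hz
  have hz1 : ‖z‖ ≤ 1 := by
    refine (norm_convex_comb_le hs).trans ?_
    rw [Complex.norm_exp_ofReal_mul_I]
    linarith
  have hexp : ‖Complex.exp (θ * Complex.I) - 1‖ ≤ |θ| := by
    have := Real.norm_exp_I_mul_ofReal_sub_one_le (x := θ)
    rwa [mul_comm, Real.norm_eq_abs] at this
  have h1s : ‖(1 : ℂ) - s‖ ≤ 1 := by
    have h : (1 : ℂ) - s = ((1 - s : ℝ) : ℂ) := by push_cast; rfl
    rw [h, Complex.norm_real, Real.norm_of_nonneg (by linarith [hs.2])]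
    linarith [hs.1]
  have hzsub : z - 1 = (1 - s) * (Complex.exp (θ * Complex.I) - 1) := by rw [hz]; ring
  have hd : ‖z - 1‖ ≤ |θ| := by
    rw [hzsub, norm_mul]
    exact (mul_le_of_le_one_left (norm_nonneg _) h1s).trans hexp
  have hd2 : ‖z - 1‖ ^ 2 ≤ θ ^ 2 := by
    rw [← sq_abs θ]
    gcongr
  have hre : 1 - z.re ≤ θ ^ 2 := by
    have h : z.re = s + (1 - s) * Real.cos θ := by
      rw [hz]
      simp [Complex.exp_ofReal_mul_I_re, Complex.exp_ofReal_mul_I_im]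
    rw [h]
    have := Real.one_sub_sq_div_two_le_cos (x := θ)
    nlinarith [hs.1, hs.2, Real.cos_le_one θ, sq_nonneg θ]
  have hpos : (0 : ℝ) < m2 + 1 := by linarith
  have hθ1 : |θ| * (2 * (m2 + 1)) ≤ 1 :=
    (le_div_iff₀ (by positivity)).1 (hθ.trans (min_le_left _ _))
  have hθ2 : |θ| * (2 * (m2 + 1)) ≤ F :=
    (le_div_iff₀ (by positivity)).1 (hθ.trans (min_le_right _ _))
  have hθ0 := abs_nonneg θ
  constructor
  · refine le_trans ?_ (ch.one_sub_le_norm_lengthGen hM hz1)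
    rw [← hm2]
    have ht : 2 * m2 * θ ^ 2 ≤ 1 / 2 := by
      rw [← sq_abs θ]
      have : |θ| ≤ 1 / 2 := by nlinarith
      nlinarith [mul_nonneg hm0 hθ0]
    have hle : 1 - 2 * m2 * θ ^ 2 ≤ 1 - m2 * (1 - z.re + ‖z - 1‖ ^ 2) := by
      nlinarith [mul_le_mul_of_nonneg_left (add_le_add hre hd2) hm0]
    refine le_trans ?_ hle
    set y := 2 * m2 * θ ^ 2 with hy
    have hy0 : 0 ≤ y := by positivity
    have he : -(4 * m2 * θ ^ 2) = -(2 * y) := by rw [hy]; ring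
    rw [he, Real.exp_neg, inv_le_comm₀ (Real.exp_pos _) (by linarith)]
    refine le_trans ?_ (Real.add_one_le_exp (2 * y))
    rw [inv_le_iff_one_le_mul₀ (by linarith)]
    nlinarith
  · have h := ch.norm_replicationGen_sub_le hM hz1
    have h2 := norm_sub_norm_le (ch.replicationGen 1) (ch.replicationGen z)
    rw [norm_sub_rev] at h2
    have h3 : m2 * ‖z - 1‖ ≤ m2 * |θ| := by gcongr
    rw [← hFdef] at h2
    rw [← hm2] at h
    nlinarith

/-- Mean traces of distinct strings are at `ℓ¹` distance at least `exp (-C n ^ (1 / 3))`. -/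
theorem exists_l1Dist_meanTrace_lower_bound
    (hM : lexp ch.law (fun a => (a.1 : ℝ≥0∞) ^ 2) ≠ ⊤) :
    ∃ C : ℝ, 0 < C ∧ ∀ (n : ℕ) (x x' : Fin n → ℤˣ), x ≠ x' →
      ENNReal.ofReal (Real.exp (-(C * (n : ℝ) ^ (1 / 3 : ℝ)))) ≤
        l1Dist (ch.meanTrace x) (ch.meanTrace x') := by
  obtain ⟨r, hr, hr1, harc⟩ := ch.exists_arc_lower_bound
  obtain ⟨σ, θ₀, κ, hσ, hθ₀, hκ, hgen⟩ := ch.lengthGen_replicationGen_lower_bound hM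
  have hp : 0 < 1 - 2 * (ch.pflip : ℝ) := by
    have h := ch.pflip_lt_half
    have : (ch.pflip : ℝ) < 1 / 2 := by exact_mod_cast h
    linarith
  set D : ℝ := (1 - 2 * (ch.pflip : ℝ)) * κ / 2 with hD
  have hD0 : 0 < D := by positivity
  set A : ℝ := max 1 (Real.pi / θ₀) with hA
  have hA1 : 1 ≤ A := le_max_left _ _
  set C : ℝ := |Real.log D| + σ * Real.pi ^ 2 + (A + 1) * (-Real.log r) + 1 with hC
  have hlr : 0 ≤ -Real.log r := by linarith [Real.log_nonpos hr.le hr1]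
  refine ⟨C, by positivity, fun n x x' hx => ?_⟩
  obtain ⟨k, N, b, hk, hb, hb0, hbN, hsum⟩ := exists_signed_coeffs hx
  have hn : 1 ≤ n := by
    rcases Nat.eq_zero_or_pos n with rfl | h
    · exact absurd (Subsingleton.elim x x') hx
    · exact h
  set y : ℝ := (n : ℝ) ^ (1 / 3 : ℝ) with hy
  have hn1 : (1 : ℝ) ≤ n := by exact_mod_cast hn
  have hy1 : 1 ≤ y := Real.one_le_rpow hn1 (by norm_num)
  have hy3 : y ^ 3 = n := by
    rw [hy, ← Real.rpow_natCast, ← Real.rpow_mul (by positivity)]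
    norm_num
  -- `L` is of order `n ^ (1 / 3)`, so that `σ * θ ^ 2 * n` and `L * (-log r)` are both `O(y)`; the
  -- factor `A` forces `π / L ≤ θ₀`.
  set L : ℕ := ⌈A * y⌉₊ with hL
  have hLle : A * y ≤ L := Nat.le_ceil _
  have hLlt : (L : ℝ) ≤ (A + 1) * y := by
    have := Nat.ceil_lt_add_one (show 0 ≤ A * y by positivity)
    rw [← hL] at this
    linarith
  have hL0 : (0 : ℝ) < L := lt_of_lt_of_le (by positivity) hLle
  have hLy : y ≤ L := by nlinarith
  have hLA : A ≤ L := by nlinarith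
  obtain ⟨s, hs, θ, hθ, hle⟩ := harc b N L hb hb0 hbN (by exact_mod_cast hL0)
  set z := (s : ℂ) + (1 - s) * Complex.exp (θ * Complex.I) with hz
  have hθle : |θ| ≤ θ₀ := by
    refine hθ.trans ?_
    rw [div_le_iff₀ hL0]
    have := (div_le_iff₀ hθ₀).1 ((le_max_right 1 (Real.pi / θ₀)).trans hLA)
    linarith
  obtain ⟨hgz, hFz⟩ := hgen s hs θ hθle
  rw [← hz] at hgz hFz
  have hz1 : ‖z‖ ≤ 1 := by
    refine (norm_convex_comb_le hs).trans ?_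
    rw [Complex.norm_exp_ofReal_mul_I]
    linarith
  refine le_trans ?_ (ch.enorm_le_l1Dist_meanTrace x (ch.lexp_length_ne_top hM) hz1 x')
  rw [hsum, ← ofReal_norm]
  refine ENNReal.ofReal_le_ofReal ?_
  have hpn : ‖(1 : ℂ) - 2 * ((ch.pflip : ℝ) : ℂ)‖ = 1 - 2 * (ch.pflip : ℝ) := by
    have h : (1 : ℂ) - 2 * ((ch.pflip : ℝ) : ℂ) = ((1 - 2 * (ch.pflip : ℝ) : ℝ) : ℂ) := by
      push_cast; rfl
    rw [h, Complex.norm_real, Real.norm_of_nonneg hp.le]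
  have hθn : σ * θ ^ 2 * n ≤ σ * Real.pi ^ 2 * y := by
    have h1 : |θ| * L ≤ Real.pi := (le_div_iff₀ hL0).1 hθ
    have h2 : |θ| * y ≤ Real.pi := (mul_le_mul_of_nonneg_left hLy (abs_nonneg θ)).trans h1
    have h3 : θ ^ 2 * y ^ 2 ≤ Real.pi ^ 2 := by
      rw [← sq_abs θ, ← mul_pow]
      gcongr
    rw [← hy3]
    calc σ * θ ^ 2 * y ^ 3 = σ * (θ ^ 2 * y ^ 2) * y := by ring
      _ ≤ σ * Real.pi ^ 2 * y := by gcongr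
  have hgk : Real.exp (-(σ * Real.pi ^ 2 * y)) ≤ ‖ch.lengthGen z‖ ^ k := by
    calc _ ≤ Real.exp (-(σ * θ ^ 2)) ^ k := by
          rw [← Real.exp_nat_mul]
          refine Real.exp_le_exp.2 ?_
          have : (k : ℝ) * (σ * θ ^ 2) ≤ n * (σ * θ ^ 2) := by gcongr
          linarith
      _ ≤ _ := by gcongr
  have hrL : Real.exp (-((A + 1) * (-Real.log r) * y)) ≤ r ^ L := by
    rw [← Real.exp_log hr, ← Real.exp_nat_mul, Real.exp_log hr]
    refine Real.exp_le_exp.2 ?_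
    nlinarith
  have hDy : Real.exp (-(|Real.log D| * y)) ≤ D := by
    conv_rhs => rw [← Real.exp_log hD0]
    refine Real.exp_le_exp.2 ?_
    nlinarith [neg_abs_le (Real.log D), abs_nonneg (Real.log D)]
  simp only [norm_mul, norm_pow, hpn, Complex.norm_ofNat]
  calc Real.exp (-(C * y)) ≤ Real.exp (-(|Real.log D| * y)) * (Real.exp (-(σ * Real.pi ^ 2 * y)) *
        Real.exp (-((A + 1) * (-Real.log r) * y))) := by
        rw [← Real.exp_add, ← Real.exp_add]
        refine Real.exp_le_exp.2 ?_
        rw [hC]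
        linarith
    _ ≤ D * (‖ch.lengthGen z‖ ^ k * r ^ L) := by gcongr
    _ = (1 - 2 * (ch.pflip : ℝ)) * κ * (2 * (‖ch.lengthGen z‖ ^ k * (r ^ L / 4))) := by
        rw [hD]; ring
    _ ≤ _ := by gcongr

end ReplicationInsertionChannel

/-! ### Exponential moments of the block and trace lengths -/

section Moments

theorem lintegral_toMeasure (p : PMF (List ℤˣ)) (f : List ℤˣ → ℝ≥0∞) :
    ∫⁻ y, f y ∂p.toMeasure = lexp p f := by
  rw [lintegral_countable', lexp]
  exact tsum_congr fun y => by
    rw [p.toMeasure_apply_singleton y (measurableSet_singleton y), mul_comm]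

theorem exists_lexp_exp_length_ne_top (ch : ReplicationInsertionChannel)
    (hM : IsSubExponential (fun m : ℕ => (m : ℝ)) ch.lengthLaw.toMeasure) :
    ∃ β : ℝ, 0 < β ∧ lexp ch.law (fun a => ENNReal.ofReal (Real.exp β) ^ a.1) ≠ ⊤ := by
  obtain ⟨α, hα, h⟩ := hM
  -- Half the tail rate leaves a geometric series of ratio `exp (-α / 2)`.
  refine ⟨α / 2, by positivity, ?_⟩
  have h1 : ∀ k : ℕ, ch.lengthLaw k ≤ ENNReal.ofReal (2 * Real.exp (-α * k)) := by
    intro k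
    rw [← ch.lengthLaw.toMeasure_apply_singleton k (measurableSet_singleton k),
      ENNReal.le_ofReal_iff_toReal_le (measure_ne_top _ _) (by positivity)]
    refine le_trans ?_ (h k (by positivity))
    exact measureReal_mono (by rintro _ rfl; simp)
  have h2 : lexp ch.lengthLaw (fun k => ENNReal.ofReal (Real.exp (α / 2)) ^ k) ≠ ⊤ := by
    refine ne_top_of_le_ne_top (b := ∑' k : ℕ, ENNReal.ofReal (2 * Real.exp (-(α / 2)) ^ k)) ?_
      (ENNReal.tsum_le_tsum fun k => ?_)
    · refine Summable.tsum_ofReal_ne_top (Summable.mul_left _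
        (summable_geometric_of_lt_one (Real.exp_pos _).le ?_))
      rw [Real.exp_lt_one_iff]
      linarith
    · refine (mul_le_mul_left (h1 k) _).trans_eq ?_
      beta_reduce
      rw [← ENNReal.ofReal_pow (Real.exp_pos _).le, ← ENNReal.ofReal_mul (by positivity), mul_assoc,
        ← Real.exp_nat_mul, ← Real.exp_nat_mul, ← Real.exp_add]
      congr 3
      ring
  rwa [ReplicationInsertionChannel.lengthLaw, lexp_map] at h2

theorem lexp_sq_length_ne_top (ch : ReplicationInsertionChannel) {β : ℝ} (hβ : 0 < β)
    (h : lexp ch.law (fun a => ENNReal.ofReal (Real.exp β) ^ a.1) ≠ ⊤) :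
    lexp ch.law (fun a => (a.1 : ℝ≥0∞) ^ 2) ≠ ⊤ := by
  refine ne_top_of_le_ne_top (ENNReal.mul_ne_top (ENNReal.ofReal_ne_top (r := 2 / β ^ 2)) h) ?_
  rw [← lexp_const_mul]
  refine lexp_mono _ fun a => ?_
  rw [← ENNReal.ofReal_natCast, ← ENNReal.ofReal_pow (by positivity),
    ← ENNReal.ofReal_pow (by positivity), ← ENNReal.ofReal_mul (by positivity)]
  refine ENNReal.ofReal_le_ofReal ?_
  have := Real.pow_div_factorial_le_exp (x := a.1 * β) (by positivity) 2
  rw [← Real.exp_nat_mul, div_mul_eq_mul_div, le_div_iff₀ (by positivity)]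
  norm_num at this
  nlinarith

/-- Pointwise, `l - N ≤ exp (β (l - N)) / β`; the subtraction is truncated, so strings no longer
than `N` contribute nothing. -/
theorem lexp_length_sub_le (p : PMF (List ℤˣ)) {β : ℝ} (hβ : 0 < β) (N : ℕ) :
    lexp p (fun y => ((y.length - N : ℕ) : ℝ≥0∞)) ≤
      ENNReal.ofReal (Real.exp (-(β * N)) / β) *
        lexp p fun y => ENNReal.ofReal (Real.exp β) ^ y.length := by
  rw [← lexp_const_mul]
  refine lexp_mono _ fun y => ?_
  rcases le_total y.length N with hle | hle
  · simp [Nat.sub_eq_zero_of_le hle]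
  rw [← ENNReal.ofReal_natCast, ← ENNReal.ofReal_pow (by positivity),
    ← ENNReal.ofReal_mul (by positivity)]
  refine ENNReal.ofReal_le_ofReal ?_
  rw [← Real.exp_nat_mul, div_mul_eq_mul_div, ← Real.exp_add, le_div_iff₀ hβ, Nat.cast_sub hle]
  have := Real.add_one_le_exp (-(β * N) + y.length * β)
  linarith

end Moments

/-! ### Concentration of the empirical mean in `ℓ¹` -/

section Concentration

variable (p : PMF (List ℤˣ)) {t : ℕ}

theorem integral_eval_padded (j : Fin t) (i : ℕ) :
    ∫ T : Fin t → List ℤˣ, padded (T j) i ∂(Measure.pi fun _ => p.toMeasure) =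
      ∫ y, padded y i ∂p.toMeasure :=
  integral_comp_eval (μ := fun _ : Fin t => p.toMeasure) (i := j) (f := fun y => padded y i)
    (measurable_of_countable _).aestronglyMeasurable

/-- Hoeffding's inequality for a coordinate of the empirical mean. -/
theorem measureReal_le_abs_empiricalMean_sub (ht : 0 < t) (i : ℕ) {η : ℝ} (hη : 0 ≤ η) :
    (Measure.pi fun _ : Fin t => p.toMeasure).real
      {T | η ≤ |(∫ y, padded y i ∂p.toMeasure) - empiricalMean T i|} ≤
      2 * Real.exp (-(t * η ^ 2 / 2)) := by
  set P := Measure.pi fun _ : Fin t => p.toMeasure with hP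
  set m := ∫ y, padded y i ∂p.toMeasure with hm
  have htR : (0 : ℝ) < t := by exact_mod_cast ht
  have hsub : ∀ j : Fin t,
      ProbabilityTheory.HasSubgaussianMGF (fun T : Fin t → List ℤˣ => padded (T j) i - m) 1 P := by
    intro j
    have h := ProbabilityTheory.hasSubgaussianMGF_of_mem_Icc (μ := P) (a := -1) (b := 1)
      (X := fun T : Fin t → List ℤˣ => padded (T j) i) (measurable_of_countable _).aemeasurable
      (Filter.Eventually.of_forall fun T => abs_le.1 (abs_padded_le (T j) i))
    rw [hP, integral_eval_padded, ← hm] at h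
    convert h using 1
    ext
    norm_num
  -- The Hoeffding bound is one-sided, so the two signs are treated separately; this is the factor
  -- `2`.
  have hneg : ∀ j : Fin t,
      ProbabilityTheory.HasSubgaussianMGF (fun T : Fin t → List ℤˣ => m - padded (T j) i) 1 P := by
    intro j
    have := (hsub j).neg
    convert this using 1
    ext T
    simp
  have hind : ProbabilityTheory.iIndepFun
      (fun (j : Fin t) (T : Fin t → List ℤˣ) => padded (T j) i - m) P :=
    ProbabilityTheory.iIndepFun_pi (X := fun _ y => padded y i - m)
      fun j => (measurable_of_countable _).aemeasurable
  have hind' : ProbabilityTheory.iIndepFun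
      (fun (j : Fin t) (T : Fin t → List ℤˣ) => m - padded (T j) i) P :=
    ProbabilityTheory.iIndepFun_pi (X := fun _ y => m - padded y i)
      fun j => (measurable_of_countable _).aemeasurable
  have hpow : -(t * η) ^ 2 / (2 * ((∑ _j : Fin t, (1 : ℝ≥0) : ℝ≥0) : ℝ)) = -(t * η ^ 2 / 2) := by
    simp
    field_simp
  have h1 := ProbabilityTheory.HasSubgaussianMGF.measure_sum_ge_le_of_iIndepFun hind
    (s := Finset.univ) (fun j _ => hsub j) (ε := t * η) (by positivity)
  have h2 := ProbabilityTheory.HasSubgaussianMGF.measure_sum_ge_le_of_iIndepFun hind'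
    (s := Finset.univ) (fun j _ => hneg j) (ε := t * η) (by positivity)
  rw [hpow] at h1 h2
  have hincl : {T : Fin t → List ℤˣ | η ≤ |m - empiricalMean T i|} ⊆
      {T | t * η ≤ ∑ j, (padded (T j) i - m)} ∪ {T | t * η ≤ ∑ j, (m - padded (T j) i)} := by
    intro T hT
    have he : (t : ℝ) * (m - empiricalMean T i) = ∑ j, (m - padded (T j) i) := by
      rw [empiricalMean, Finset.sum_sub_distrib]
      simp
      field_simp
    have he' : ∑ j, (padded (T j) i - m) = -∑ j, (m - padded (T j) i) := by
      rw [← Finset.sum_neg_distrib]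
      simp
    simp only [Set.mem_union, Set.mem_ofPred_eq, he', ← he] at hT ⊢
    rcases le_abs.1 hT with h | h
    · right
      gcongr
    · left
      rw [← mul_neg]
      gcongr
  calc _ ≤ _ := measureReal_mono hincl
    _ ≤ _ := measureReal_union_le _ _
    _ ≤ _ := add_le_add h1 h2
    _ = _ := by ring

theorem tsum_ofReal_abs_padded_le (y : List ℤˣ) (N : ℕ) :
    ∑' i, ENNReal.ofReal |padded y (i + N)| ≤ (y.length - N : ℕ) := by
  rw [tsum_eq_sum (s := Finset.range (y.length - N))]
  · refine (Finset.sum_le_sum fun i _ => ENNReal.ofReal_le_ofReal (abs_padded_le y (i + N))).trans ?_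
    simp
  · intro i hi
    rw [padded_of_length_le (by simp at hi; omega)]
    simp

theorem tsum_ofReal_abs_integral_padded_le (N : ℕ) :
    ∑' i, ENNReal.ofReal |∫ y, padded y (i + N) ∂p.toMeasure| ≤
      lexp p fun y => ((y.length - N : ℕ) : ℝ≥0∞) := by
  calc _ ≤ ∑' i, lexp p fun y => ENNReal.ofReal |padded y (i + N)| := by
        refine ENNReal.tsum_le_tsum fun i => ?_
        rw [← lintegral_toMeasure]
        have h := enorm_integral_le_lintegral_enorm (μ := p.toMeasure)
          (fun y => padded y (i + N))
        simpa only [← ofReal_norm, Real.norm_eq_abs] using h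
    _ = lexp p fun y => ∑' i, ENNReal.ofReal |padded y (i + N)| := by
        simp only [lexp, ← ENNReal.tsum_mul_left]
        exact ENNReal.tsum_comm
    _ ≤ _ := lexp_mono _ fun y => tsum_ofReal_abs_padded_le y N

theorem tsum_ofReal_abs_empiricalMean_le (T : Fin t → List ℤˣ) (N : ℕ) :
    ∑' i, ENNReal.ofReal |empiricalMean T (i + N)| ≤
      ENNReal.ofReal (1 / t) * ∑ j, (((T j).length - N : ℕ) : ℝ≥0∞) := by
  calc _ ≤ ∑' i, ENNReal.ofReal (1 / t) * ∑ j, ENNReal.ofReal |padded (T j) (i + N)| := by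
        refine ENNReal.tsum_le_tsum fun i => ?_
        rw [← ENNReal.ofReal_sum_of_nonneg (fun _ _ => abs_nonneg _),
          ← ENNReal.ofReal_mul (by positivity)]
        refine ENNReal.ofReal_le_ofReal ?_
        rw [empiricalMean, abs_mul, abs_of_nonneg (by positivity)]
        gcongr
        exact Finset.abs_sum_le_sum_abs _ _
    _ = ENNReal.ofReal (1 / t) * ∑ j, ∑' i, ENNReal.ofReal |padded (T j) (i + N)| := by
        rw [ENNReal.tsum_mul_left, Summable.tsum_finsetSum fun _ _ => ENNReal.summable]
    _ ≤ _ := by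
        gcongr
        exact tsum_ofReal_abs_padded_le _ N

/-- The first `N` coordinates are compared one by one. Beyond them both tails are bounded
separately, since the padded letters of a string past `N` have `ℓ¹` norm at most its excess length.
-/
theorem l1Dist_integral_empiricalMean_le (T : Fin t → List ℤˣ) (N : ℕ) :
    l1Dist (fun i => ∫ y, padded y i ∂p.toMeasure) (empiricalMean T) ≤
      ∑ i ∈ Finset.range N,
        ENNReal.ofReal |(∫ y, padded y i ∂p.toMeasure) - empiricalMean T i| +
      (lexp p (fun y => ((y.length - N : ℕ) : ℝ≥0∞)) +
        ENNReal.ofReal (1 / t) * ∑ j, (((T j).length - N : ℕ) : ℝ≥0∞)) := by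
  rw [l1Dist, ← Summable.sum_add_tsum_nat_add' (k := N) ENNReal.summable]
  refine add_le_add le_rfl ?_
  refine le_trans ?_ (add_le_add (tsum_ofReal_abs_integral_padded_le p N)
    (tsum_ofReal_abs_empiricalMean_le T N))
  rw [← ENNReal.tsum_add]
  refine ENNReal.tsum_le_tsum fun i => ?_
  rw [← ENNReal.ofReal_add (abs_nonneg _) (abs_nonneg _)]
  exact ENNReal.ofReal_le_ofReal (abs_sub _ _)

/-- Markov's inequality for the average excess length of the traces. -/
theorem measureReal_le_mean_excess_length (ht : 0 < t) (N : ℕ) {a u : ℝ} (ha : 0 < a)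
    (hu0 : 0 ≤ u) (hu : lexp p (fun y => ((y.length - N : ℕ) : ℝ≥0∞)) ≤ ENNReal.ofReal u) :
    (Measure.pi fun _ : Fin t => p.toMeasure).real
      {T | ENNReal.ofReal a ≤ ENNReal.ofReal (1 / t) * ∑ j, (((T j).length - N : ℕ) : ℝ≥0∞)} ≤
      u / a := by
  set P := Measure.pi fun _ : Fin t => p.toMeasure with hP
  have htR : (0 : ℝ) < t := by exact_mod_cast ht
  have hint : ∫⁻ T : Fin t → List ℤˣ,
      ENNReal.ofReal (1 / t) * ∑ j, (((T j).length - N : ℕ) : ℝ≥0∞) ∂P ≤ ENNReal.ofReal u := by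
    rw [lintegral_const_mul _ (measurable_of_countable _),
      lintegral_finsetSum _ (fun _ _ => measurable_of_countable _)]
    have hj : ∀ j : Fin t, ∫⁻ T : Fin t → List ℤˣ, (((T j).length - N : ℕ) : ℝ≥0∞) ∂P =
        lexp p (fun y => ((y.length - N : ℕ) : ℝ≥0∞)) := fun j => by
      rw [← lintegral_toMeasure]
      exact (measurePreserving_eval (fun _ : Fin t => p.toMeasure) j).lintegral_comp
        (f := fun y : List ℤˣ => ((y.length - N : ℕ) : ℝ≥0∞)) (measurable_of_countable _)
    simp only [hj, Finset.sum_const, Finset.card_univ, Fintype.card_fin, nsmul_eq_mul]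
    rw [← mul_assoc, ← ENNReal.ofReal_natCast, ← ENNReal.ofReal_mul (by positivity),
      one_div_mul_cancel htR.ne', ENNReal.ofReal_one, one_mul]
    exact hu
  have hmk := meas_ge_le_lintegral_div (μ := P)
    (f := fun T : Fin t → List ℤˣ =>
      ENNReal.ofReal (1 / t) * ∑ j, (((T j).length - N : ℕ) : ℝ≥0∞))
    (measurable_of_countable _).aemeasurable (ε := ENNReal.ofReal a)
    (by simpa using ha) ENNReal.ofReal_ne_top
  rw [Measure.real]
  refine ENNReal.toReal_le_of_le_ofReal (by positivity) (hmk.trans ?_)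
  rw [ENNReal.ofReal_div_of_pos ha]
  gcongr

theorem measureReal_le_l1Dist_empiricalMean (ht : 0 < t) (N : ℕ) {η a u s : ℝ} (hη : 0 ≤ η)
    (ha : 0 < a) (hu0 : 0 ≤ u)
    (hu : lexp p (fun y => ((y.length - N : ℕ) : ℝ≥0∞)) ≤ ENNReal.ofReal u)
    (hs : N * η + (u + a) < s) :
    (Measure.pi fun _ : Fin t => p.toMeasure).real
      {T | ENNReal.ofReal s ≤ l1Dist (fun i => ∫ y, padded y i ∂p.toMeasure) (empiricalMean T)} ≤
      N * (2 * Real.exp (-(t * η ^ 2 / 2))) + u / a := by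
  set P := Measure.pi fun _ : Fin t => p.toMeasure with hP
  have hincl : {T : Fin t → List ℤˣ | ENNReal.ofReal s ≤
        l1Dist (fun i => ∫ y, padded y i ∂p.toMeasure) (empiricalMean T)} ⊆
      (⋃ i ∈ Finset.range N, {T | η ≤ |(∫ y, padded y i ∂p.toMeasure) - empiricalMean T i|}) ∪
      {T | ENNReal.ofReal a ≤ ENNReal.ofReal (1 / t) * ∑ j, (((T j).length - N : ℕ) : ℝ≥0∞)} := by
    intro T hT
    by_contra hcon
    simp only [Set.mem_union, Set.mem_iUnion, Set.mem_ofPred_eq, not_or, not_exists, not_le] at hcon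
    refine (not_lt.2 (le_trans hT (l1Dist_integral_empiricalMean_le p T N))) ?_
    refine lt_of_le_of_lt (b := ENNReal.ofReal (N * η + (u + a))) ?_
      (ENNReal.ofReal_lt_ofReal_iff'.2 ⟨hs, lt_of_le_of_lt (by positivity) hs⟩)
    rw [ENNReal.ofReal_add (by positivity) (by positivity), ENNReal.ofReal_add hu0 ha.le]
    refine add_le_add ?_ (add_le_add hu hcon.2.le)
    refine (Finset.sum_le_sum fun i hi => ENNReal.ofReal_le_ofReal (hcon.1 i hi).le).trans_eq ?_
    rw [Finset.sum_const, Finset.card_range, nsmul_eq_mul, ENNReal.ofReal_mul (by positivity),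
      ENNReal.ofReal_natCast]
  refine (measureReal_mono hincl).trans ((measureReal_union_le _ _).trans (add_le_add ?_
    (measureReal_le_mean_excess_length p ht N ha hu0 hu)))
  refine (measureReal_biUnion_finset_le _ _).trans ?_
  refine (Finset.sum_le_sum fun i _ => measureReal_le_abs_empiricalMean_sub p ht i hη).trans_eq ?_
  simp

end Concentration

/-! ### The decoder and the number of traces -/

theorem l1Dist_comm (a b : ℕ → ℝ) : l1Dist a b = l1Dist b a := by
  simp only [l1Dist, abs_sub_comm]

theorem l1Dist_triangle (a b c : ℕ → ℝ) : l1Dist a c ≤ l1Dist a b + l1Dist b c := by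
  rw [l1Dist, l1Dist, l1Dist, ← ENNReal.tsum_add]
  refine ENNReal.tsum_le_tsum fun i => ?_
  rw [← ENNReal.ofReal_add (abs_nonneg _) (abs_nonneg _)]
  exact ENNReal.ofReal_le_ofReal (abs_sub_le _ _ _)

namespace ReplicationInsertionChannel

variable (ch : ReplicationInsertionChannel)

instance isProbabilityMeasure_tracesMeasure {n : ℕ} (x : Fin n → ℤˣ) (t : ℕ) :
    IsProbabilityMeasure (ch.tracesMeasure x t) := by
  unfold tracesMeasure
  infer_instance

/-- A mean-based decoder succeeds whenever the empirical mean is closer to the mean trace than half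
the separation of mean traces. -/
theorem one_sub_le_measureReal_decoder {n t : ℕ} {dec : (ℕ → ℝ) → (Fin n → ℤˣ)}
    (hdec : ch.IsMeanBasedDecoder dec) (x : Fin n → ℤˣ) {s : ℝ} (hs : 0 ≤ s)
    (hsep : ∀ x', x ≠ x' →
      ENNReal.ofReal (2 * s) ≤ l1Dist (ch.meanTrace x) (ch.meanTrace x')) :
    1 - (ch.tracesMeasure x t).real
        {T | ENNReal.ofReal s ≤ l1Dist (ch.meanTrace x) (empiricalMean T)} ≤
      (ch.tracesMeasure x t).real {T | dec (empiricalMean T) = x} := by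
  have hcover : (Set.univ : Set (Fin t → List ℤˣ)) ⊆ {T | dec (empiricalMean T) = x} ∪
      {T | ENNReal.ofReal s ≤ l1Dist (ch.meanTrace x) (empiricalMean T)} := by
    intro T _
    by_contra hcon
    simp only [Set.mem_union, Set.mem_ofPred_eq, not_or, not_le] at hcon
    have h1 := (hdec (empiricalMean T) x).trans_lt hcon.2
    have h2 := (hsep _ (Ne.symm hcon.1)).trans
      (l1Dist_triangle _ (empiricalMean T) _)
    rw [l1Dist_comm (empiricalMean T)] at h2
    refine absurd (h2.trans_lt (ENNReal.add_lt_add hcon.2 h1)) ?_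
    rw [← ENNReal.ofReal_add hs hs, two_mul]
    exact lt_irrefl _
  have h := (measureReal_mono (μ := ch.tracesMeasure x t) hcover).trans
    (measureReal_union_le _ _)
  rw [probReal_univ] at h
  linarith

theorem measureReal_l1Dist_meanTrace_le {n : ℕ} (x : Fin n → ℤˣ) {t : ℕ} (ht : 0 < t)
    {β : ℝ} (hβ : 0 < β) (hG : lexp ch.law (fun a => ENNReal.ofReal (Real.exp β) ^ a.1) ≠ ⊤)
    (N : ℕ) {η a s : ℝ} (hη : 0 ≤ η) (ha : 0 < a)
    (hs : N * η + (Real.exp (-(β * N)) / β *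
      (lexp ch.law fun a => ENNReal.ofReal (Real.exp β) ^ a.1).toReal ^ n + a) < s) :
    (ch.tracesMeasure x t).real
      {T | ENNReal.ofReal s ≤ l1Dist (ch.meanTrace x) (empiricalMean T)} ≤
      N * (2 * Real.exp (-(t * η ^ 2 / 2))) + Real.exp (-(β * N)) / β *
        (lexp ch.law fun a => ENNReal.ofReal (Real.exp β) ^ a.1).toReal ^ n / a := by
  refine measureReal_le_l1Dist_empiricalMean (ch.traceLaw x) ht N hη ha (by positivity) ?_ hs
  refine (lexp_length_sub_le _ hβ N).trans_eq ?_
  rw [lexp_pow_length_traceLaw, ENNReal.ofReal_mul (by positivity),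
    ENNReal.ofReal_pow ENNReal.toReal_nonneg, ENNReal.ofReal_toReal hG]

/-- A choice of truncation length, accuracy and number of traces making the failure probability
exponentially small. -/
theorem exists_sample_bound {β G C₀ : ℝ} (hβ : 0 < β) (hG : 0 ≤ G) (hC₀ : 0 < C₀) :
    ∃ (C : ℝ) (K : ℕ), 0 < C ∧ ∀ n t : ℕ, 1 ≤ n →
      Real.exp (C * (n : ℝ) ^ (1 / 3 : ℝ)) ≤ (t : ℝ) →
      ∃ η a : ℝ, 0 ≤ η ∧ 0 < a ∧
        ((K * n : ℕ) : ℝ) * η + (Real.exp (-(β * (K * n : ℕ))) / β * G ^ n + a) <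
          Real.exp (-(C₀ * (n : ℝ) ^ (1 / 3 : ℝ))) / 2 ∧
        ((K * n : ℕ) : ℝ) * (2 * Real.exp (-(t * η ^ 2 / 2))) +
          Real.exp (-(β * (K * n : ℕ))) / β * G ^ n / a ≤ Real.exp (-(n : ℝ)) := by
  -- In the exponent, `G` absorbs `G ^ n`, `C₀` the factor `S` below, `1` the target `exp (-n)`, and
  -- `16 / β` the constant `16 / β`.
  obtain ⟨K₀, hK₀⟩ := exists_nat_ge ((G + C₀ + 1 + 16 / β) / β)
  set K : ℕ := K₀ + 1 with hK
  have hKβ : G + C₀ + 1 + 16 / β ≤ β * K := by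
    have := (div_le_iff₀ hβ).1 hK₀
    rw [hK]
    push_cast
    linarith
  have hK1 : (1 : ℝ) ≤ K := by rw [hK]; push_cast; linarith [Nat.cast_nonneg (α := ℝ) K₀]
  set Q : ℝ := 128 * K ^ 2 * (1 + 4 * K) * (Nat.factorial 9 : ℝ) with hQ
  have hf1 : (1 : ℝ) ≤ (Nat.factorial 9 : ℝ) := by exact_mod_cast Nat.factorial_pos 9
  have hQ0 : 0 < Q := by positivity
  -- The term `2 * C₀` pays for `S ^ 2`, `1` for `n ^ 3 = y ^ 9 ≤ 9! * exp y`, and `Q` for the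
  -- remaining constant factor.
  refine ⟨2 * C₀ + 1 + Q, K, by positivity, fun n t hn ht => ?_⟩
  set y : ℝ := (n : ℝ) ^ (1 / 3 : ℝ) with hy
  have hn1 : (1 : ℝ) ≤ n := by exact_mod_cast hn
  have hy1 : 1 ≤ y := Real.one_le_rpow hn1 (by norm_num)
  have hy3 : y ^ 3 = n := by
    rw [hy, ← Real.rpow_natCast, ← Real.rpow_mul (by positivity)]
    norm_num
  have hyn : y ≤ n := by rw [← hy3]; exact le_self_pow₀ hy1 (by norm_num)
  set S : ℝ := Real.exp (-(C₀ * y)) with hS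
  have hS0 : 0 < S := Real.exp_pos _
  have hKn : (1 : ℝ) ≤ K * n := one_le_mul_of_one_le_of_one_le hK1 hn1
  push_cast
  have hu : Real.exp (-(β * (K * n))) / β * G ^ n ≤ S / 16 * Real.exp (-(n : ℝ)) := by
    have h1 : G ^ n ≤ Real.exp (G * n) := by
      rw [mul_comm, Real.exp_nat_mul]
      gcongr
      linarith [Real.add_one_le_exp G]
    have h2 : 16 / β ≤ Real.exp (16 / β * n) := by
      have h3 : 16 / β ≤ 16 / β * n := le_mul_of_one_le_right (by positivity) hn1
      linarith [Real.add_one_le_exp (16 / β * n)]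
    calc Real.exp (-(β * (K * n))) / β * G ^ n
        = Real.exp (-(β * (K * n))) * (16 / β) * G ^ n / 16 := by field_simp
      _ ≤ Real.exp (-(β * (K * n))) * Real.exp (16 / β * n) * Real.exp (G * n) / 16 := by gcongr
      _ = Real.exp (-(β * (K * n)) + 16 / β * n + G * n) / 16 := by
        rw [Real.exp_add, Real.exp_add]
      _ ≤ Real.exp (-(C₀ * y) + -n) / 16 := by
        refine div_le_div_of_nonneg_right (Real.exp_le_exp.2 ?_) (by norm_num)
        nlinarith [mul_le_mul_of_nonneg_right hKβ (by positivity : (0 : ℝ) ≤ n),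
          mul_le_mul_of_nonneg_left hyn hC₀.le]
      _ = S / 16 * Real.exp (-(n : ℝ)) := by rw [Real.exp_add]; ring
  have hen : Real.exp (-(n : ℝ)) ≤ 1 := Real.exp_le_one_iff.2 (by linarith)
  -- The error budget is `S / 8` for the coordinates, at most `S / 16` for the expected tail and `S
  -- / 8` for the empirical tail, in total less than `S / 2`.
  refine ⟨S / (8 * (K * n)), S / 8, by positivity, by positivity, ?_, ?_⟩
  · have h1 : (K : ℝ) * n * (S / (8 * (K * n))) = S / 8 := by field_simp
    rw [h1]
    nlinarith
  · have h2 : Real.exp (-(β * (K * n))) / β * G ^ n / (S / 8) ≤ Real.exp (-(n : ℝ)) / 2 := by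
      rw [div_le_iff₀ (by positivity)]
      linarith
    -- The surplus `4 * (K * n)` in the Hoeffding exponent pays for the union bound over `K * n`
    -- coordinates.
    have hmain : (n : ℝ) + 4 * (K * n) ≤ t * (S / (8 * (K * n))) ^ 2 / 2 := by
      have hS2 : S ^ 2 = Real.exp (-(2 * C₀ * y)) := by
        rw [hS, ← Real.exp_nat_mul]
        congr 1
        push_cast
        ring
      have h3 : Real.exp (y + Q * y) ≤ t * S ^ 2 := by
        calc Real.exp (y + Q * y) = Real.exp ((2 * C₀ + 1 + Q) * y) * S ^ 2 := by
              rw [hS2, ← Real.exp_add]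
              congr 1
              ring
          _ ≤ t * S ^ 2 := by gcongr
      have h4 : (n : ℝ) ^ 3 / (Nat.factorial 9 : ℝ) ≤ Real.exp y := by
        have := Real.pow_div_factorial_le_exp (x := y) (by positivity) 9
        rwa [← hy3, ← pow_mul]
      have h5 : Q ≤ Real.exp (Q * y) := by
        have : Q ≤ Q * y := le_mul_of_one_le_right hQ0.le hy1
        linarith [Real.add_one_le_exp (Q * y)]
      have h6 : (n : ℝ) ^ 3 / (Nat.factorial 9 : ℝ) * Q ≤ t * S ^ 2 := by
        refine le_trans ?_ h3
        rw [Real.exp_add]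
        gcongr
      have h7 : (n : ℝ) ^ 3 / (Nat.factorial 9 : ℝ) * Q =
          (n + 4 * (K * n)) * (128 * (K * n) ^ 2) := by
        rw [hQ]
        field_simp
      rw [h7] at h6
      have h8 : (t : ℝ) * (S / (8 * (K * n))) ^ 2 / 2 = t * S ^ 2 / (128 * (K * n) ^ 2) := by
        field_simp
        ring
      rw [h8, le_div_iff₀ (by positivity)]
      exact h6
    have h9 : (K : ℝ) * n * (2 * Real.exp (-(t * (S / (8 * (K * n))) ^ 2 / 2))) ≤
        Real.exp (-(n : ℝ)) / 2 := by
      calc _ ≤ (K : ℝ) * n * (2 * Real.exp (-(n + 4 * (K * n)))) := by gcongr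
        _ = Real.exp (-(n : ℝ)) / 2 * (4 * (K * n) * Real.exp (-(4 * (K * n)))) := by
          rw [neg_add, Real.exp_add]
          ring
        _ ≤ Real.exp (-(n : ℝ)) / 2 * 1 := by
          gcongr
          rw [Real.exp_neg, ← div_eq_mul_inv, div_le_one (Real.exp_pos _)]
          linarith [Real.add_one_le_exp (4 * ((K : ℝ) * n))]
        _ = _ := mul_one _
    linarith

end ReplicationInsertionChannel

end TraceReconstruction

end

/-! ### The main theorem -/

open TraceReconstruction in
theorem theorem1 (ch : ReplicationInsertionChannel)
    (hM : IsSubExponential (fun m : ℕ => (m : ℝ)) ch.lengthLaw.toMeasure) :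
    ∃ C c : ℝ, 0 < C ∧ 0 < c ∧
      ∀ (n t : ℕ), Real.exp (C * (n : ℝ) ^ (1 / 3 : ℝ)) ≤ (t : ℝ) →
        ∀ dec : (ℕ → ℝ) → (Fin n → ℤˣ), ch.IsMeanBasedDecoder dec →
          ∀ x : Fin n → ℤˣ,
            1 - Real.exp (-c * n) ≤
              (ch.tracesMeasure x t).real {T | dec (empiricalMean T) = x} := by
  obtain ⟨β, hβ, hG⟩ := exists_lexp_exp_length_ne_top ch hM
  obtain ⟨C₀, hC₀, hsep⟩ :=
    ch.exists_l1Dist_meanTrace_lower_bound (lexp_sq_length_ne_top ch hβ hG)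
  obtain ⟨C, K, hC, hbound⟩ :=
    ReplicationInsertionChannel.exists_sample_bound hβ
      (ENNReal.toReal_nonneg (a := lexp ch.law fun a => ENNReal.ofReal (Real.exp β) ^ a.1)) hC₀
  refine ⟨C, 1, hC, one_pos, fun n t ht dec hdec x => ?_⟩
  rcases Nat.eq_zero_or_pos n with rfl | hn
  -- For `n = 0` the claimed lower bound is `1 - exp 0 = 0`.
  · simp
  obtain ⟨η, a, hη, ha, hs, hfail⟩ := hbound n t hn ht
  have ht0 : 0 < t := by exact_mod_cast (Real.exp_pos _).trans_le ht
  refine le_trans ?_ (ch.one_sub_le_measureReal_decoder hdec x (half_pos (Real.exp_pos _)).le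
    fun x' hx => (congrArg ENNReal.ofReal (by ring)).trans_le (hsep n x x' hx))
  rw [neg_one_mul]
  exact sub_le_sub_left
    ((ch.measureReal_l1Dist_meanTrace_le x ht0 hβ hG (K * n) hη ha hs).trans hfail) 1
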